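/- Let $N\in\mathbb N$, $p\in(0,1)$, and let $\mathcal A\in\{0,1\}^{N\times N}$ be the adjacency matrix of the Erdős–Rényi graph $G(N,p)$: $\mathcal A$ is real symmetric and its upper-triangular entries $\mathcal A_{ij}$, $i\le j$, are independent Bernoulli random variables with mean $p$ (alternatively, only those with $i<j$, the diagonal being zero; the result is stated for both conventions). Let $A=(p(1-p)N)^{-1/2}\,\mathcal A$ be the rescaled adjacency matrix, with eigenvalues $\lambda_1\ge\dots\ge\lambda_N$ listed with multiplicity. There is an absolute constant $K>0$ such that for every $D>0$ there exist $C=C(D)>0$ and $N_0=N_0(D)$ with the following property. Let $N\ge N_0$ and suppose that $pN\ge C^2\log N$ and $\sqrt{pN}\le(\log N)^{10}$. Let $a_1,\dots,a_N\in\mathbb R$ be deterministic with $\sum_{i=1}^N a_i=0$. Then for every $k\in\{1,\dots,N\}$ and every $\theta\ge1$, with probability at least $$1-N^{-D}-\mathrm e^{-\theta\sqrt{\log\theta}},$$ every $k$-th normalized eigenvector $u_k$ of $A$ (that is, every $u_k\in\mathbb R^N$ with $A u_k=\lambda_k u_k$ and $\sum_{i=1}^N u_k(i)^2=1$; it is unique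 up to sign if $\lambda_k$ is simple) satisfies $$\Bigl|\sum_{i=1}^N a_i\,u_k(i)^2\Bigr|\le K\,\frac{\theta^2N^{(\log N)^{-1/2}}}{N}\Bigl(\sum_{i=1}^N a_i^2\Bigr)^{1/2}.$$ -/

import Mathlib

open MeasureTheory ProbabilityTheory

/-- `𝒜` is a random adjacency matrix of the Erdős–Rényi graph `G(N,p)` on the vertex set `Fin N`,
defined on the probability space `(Ω, μ)`: a random real symmetric matrix with entries in `{0,1}`
whose upper-triangular entries `𝒜 i j`, `i ≤ j`, are independent, the entries above the diagonal
being Bernoulli with mean `p`. Both usual conventions for the diagonal are allowed: either the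
diagonal entries are Bernoulli with mean `p` as well (independent loops), or they are all zero
(a simple graph; independence then adds nothing for the constant diagonal entries). -/
structure IsErdosRenyiAdjacency {Ω : Type*} [MeasurableSpace Ω] (μ : Measure Ω) {N : ℕ} (p : ℝ)
    (𝒜 : Ω → Matrix (Fin N) (Fin N) ℝ) : Prop where
  measurable_entry : ∀ i j, Measurable fun ω => 𝒜 ω i j
  zero_or_one : ∀ ω i j, 𝒜 ω i j = 0 ∨ 𝒜 ω i j = 1
  symm : ∀ ω, (𝒜 ω).IsSymm
  indep : iIndepFun
    (fun (e : {e : Fin N × Fin N // e.1 ≤ e.2}) (ω : Ω) => 𝒜 ω e.1.1 e.1.2) μ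
  bernoulli : ∀ i j, i < j → μ {ω | 𝒜 ω i j = 1} = ENNReal.ofReal p
  diagonal : (∀ i, μ {ω | 𝒜 ω i i = 1} = ENNReal.ofReal p) ∨ (∀ ω i, 𝒜 ω i i = 0)

/-- The rescaled adjacency matrix `(p (1 - p) N)^{-1/2} 𝒜`. -/
noncomputable def rescaledAdjacency {N : ℕ} (p : ℝ) (M : Matrix (Fin N) (Fin N) ℝ) :
    Matrix (Fin N) (Fin N) ℝ :=
  Real.sqrt (1 / (p * (1 - p) * N)) • M

/-- `u` is a `k`-th normalized eigenvector of the real symmetric matrix `M`: a vector of unit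
Euclidean norm in the eigenspace of the `k`-th eigenvalue of `M`. The eigenvalues are listed with
multiplicity in decreasing order (`Matrix.IsHermitian.eigenvalues₀`); `k = 0` is the largest. -/
def IsKthUnitEigenvector {N : ℕ} (M : Matrix (Fin N) (Fin N) ℝ) (k : Fin N)
    (u : Fin N → ℝ) : Prop :=
  ∃ hM : M.IsHermitian,
    M.mulVec u = hM.eigenvalues₀ (k.cast (Fintype.card_fin N).symm) • u ∧ ∑ i, u i ^ 2 = 1

/-! ### Deterministic bounds for the Green function of a real symmetric matrix. -/

section Green

variable {n : Type*} [Fintype n] [DecidableEq n]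

/-! The law of the graph is invariant under relabelling the vertices. Once every unit eigenvector is
known to be spread out, a uniformly random relabelling of the weights `a` already makes all the
quadratic forms small, because the weights sum to zero. So the theorem reduces to delocalization
plus a concentration inequality for permutation statistics. Write x for the square root of log N, so
that the factor N^((log N)^(-1/2)) is exp x.

Delocalization. Eigenvector entries are controlled by the diagonal of the Green function at an
imaginary part η close to exp(x/4)/N (`sq_eigenvector_le`), so it is enough to bound Green functions
by a constant down to that scale. This is done by dyadic bootstrap
(`greenBounded_of_notMem_atypicalRow`): halving η at most doubles the bound, and Schur's formula, an
approximate self-consistent equation for the diagonal entries, then restores it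
(`GreenBounded.improve`, `norm_le_of_self_consistent`).

The errors in Schur's formula are linear and quadratic forms in a row of the graph that is
independent of the minor (`bernoulliProb_atypicalRow_le`). The row is the indicator of a random
vertex set S of polylogarithmic size, and no centring is needed off the diagonal. By the Ward
identity each row of the minor's Green function has few entries above a threshold δ. Hence S
contains neither a large star nor a large matching of such large entries, and so only about x² large
pairs in all (`exists_matching`). The remaining pairs contribute at most δ|S|², negligible since pN
is polylogarithmic. The large pairs contribute a quantity of order x²/(pN) after rescaling, small
because pN is at least a large multiple of log N. A union bound over energies, scales and rows
finishes this part (`bernoulliProb_not_delocalized_le`).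

Permutations. For a fixed delocalized matrix, moments of the permuted sums are bounded through
exchangeable pairs built from transpositions (`sum_permSum_pow_le`). A union bound over pairs of
vectors of one orthonormal eigenbasis handles all eigenvectors, including those of multiple
eigenvalues, since delocalization also bounds multiplicities (`card_hasLargeObservable_le`).
Averaging over relabellings transfers this to the random graph
(`bernoulliProb_hasLargeObservable_le`).

This gives failure probability N^(-D) for the bound with θ = 1 and K = 1, simultaneously for all
eigenvectors; a larger θ only weakens the bound. -/

/-- The Green function `(A - z)⁻¹` of a real matrix. -/
noncomputable def greenFunction (A : Matrix n n ℝ) (z : ℂ) : Matrix n n ℂ :=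
  (A.map (fun x : ℝ => (x : ℂ)) - z • (1 : Matrix n n ℂ))⁻¹

/-- The matrix obtained from `A` by setting the `i`-th row and column to zero. -/
def isolate (A : Matrix n n ℝ) (i : n) : Matrix n n ℝ :=
  fun j k => if j = i ∨ k = i then 0 else A j k

/-- The `i`-th row of `A` with its diagonal entry set to zero. -/
def offDiagRow (A : Matrix n n ℝ) (i : n) : n → ℝ := fun j => if j = i then 0 else A i j

omit [Fintype n] in
theorem isolate_isSymm {A : Matrix n n ℝ} (hA : A.IsSymm) (i : n) : (isolate A i).IsSymm := by
  ext j k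
  simp only [Matrix.transpose_apply, isolate, or_comm, hA.apply]

/-- A kernel vector v would satisfy v*Av = z|v|², whose left side is real while the right side has
positive imaginary part. -/
theorem isUnit_det_sub_smul_one {A : Matrix n n ℝ} (hA : A.IsSymm) {z : ℂ} (hz : 0 < z.im) :
    IsUnit (A.map (fun x : ℝ => (x : ℂ)) - z • (1 : Matrix n n ℂ)).det := by
  rw [isUnit_iff_ne_zero]
  intro h
  obtain ⟨v, hv, h0⟩ := Matrix.exists_mulVec_eq_zero_iff.2 h
  have hH : (A.map (fun x : ℝ => (x : ℂ))).IsHermitian := by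
    ext j k
    simp [Matrix.conjTranspose_apply, hA.apply]
  have h1 := hH.im_star_dotProduct_mulVec_self v
  rw [Matrix.sub_mulVec, sub_eq_zero, Matrix.smul_mulVec, Matrix.one_mulVec] at h0
  rw [h0, dotProduct_smul] at h1
  have h2 : star v ⬝ᵥ v = ((∑ i, Complex.normSq (v i) : ℝ) : ℂ) := by
    simp [dotProduct, Complex.normSq_eq_conj_mul_self]
  rw [h2] at h1
  simp only [smul_eq_mul, RCLike.im_to_complex, Complex.mul_im, Complex.ofReal_im, mul_zero,
    Complex.ofReal_re, zero_add] at h1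
  rcases mul_eq_zero.1 h1 with h3 | h3
  · exact hz.ne' h3
  · apply hv
    rw [Finset.sum_eq_zero_iff_of_nonneg (fun i _ => Complex.normSq_nonneg _)] at h3
    ext i
    simpa using h3 i (Finset.mem_univ i)

variable {A : Matrix n n ℝ} (hA : A.IsSymm) {z : ℂ} (hz : 0 < z.im)
include hA

theorem greenFunction_symm (j k : n) : greenFunction A z j k = greenFunction A z k j := by
  have : (greenFunction A z).transpose = greenFunction A z := by
    rw [greenFunction, Matrix.transpose_nonsing_inv]
    congr 1
    ext a b
    simp [Matrix.one_apply, hA.apply, eq_comm]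
  calc _ = (greenFunction A z).transpose k j := rfl
    _ = _ := by rw [this]

include hz

theorem mul_greenFunction :
    (A.map (fun x : ℝ => (x : ℂ)) - z • (1 : Matrix n n ℂ)) * greenFunction A z = 1 :=
  Matrix.mul_nonsing_inv _ (isUnit_det_sub_smul_one hA hz)

theorem greenFunction_mul :
    greenFunction A z * (A.map (fun x : ℝ => (x : ℂ)) - z • (1 : Matrix n n ℂ)) = 1 :=
  Matrix.nonsing_inv_mul _ (isUnit_det_sub_smul_one hA hz)

theorem sum_mul_greenFunction (j k : n) :
    ∑ l, (A j l : ℂ) * greenFunction A z l k - z * greenFunction A z j k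
      = if j = k then 1 else 0 := by
  have := congrFun (congrFun (mul_greenFunction hA hz) j) k
  rw [Matrix.sub_mul, Matrix.smul_mul, Matrix.one_mul] at this
  simpa [Matrix.mul_apply, Matrix.one_apply] using this

theorem eq_sum_greenFunction {h c : n → ℂ}
    (hc : ∀ j, ∑ l, (A j l : ℂ) * h l - z * h j = c j) (j : n) :
    h j = ∑ l, greenFunction A z j l * c l := by
  have h1 : (A.map (fun x : ℝ => (x : ℂ)) - z • (1 : Matrix n n ℂ)).mulVec h = c := by
    ext j
    rw [Matrix.sub_mulVec, Matrix.smul_mulVec, Matrix.one_mulVec, ← hc j]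
    simp [Matrix.mulVec, dotProduct]
  have h2 : (greenFunction A z).mulVec c = h := by
    rw [← h1, Matrix.mulVec_mulVec, greenFunction_mul hA hz, Matrix.one_mulVec]
  rw [← h2]
  rfl

theorem greenFunction_sub {w : ℂ} (hw : 0 < w.im) :
    greenFunction A z - greenFunction A w
      = (z - w) • (greenFunction A z * greenFunction A w) := by
  have h1 : greenFunction A z - greenFunction A w =
      greenFunction A z * ((A.map (fun x : ℝ => (x : ℂ)) - w • (1 : Matrix n n ℂ)) -
        (A.map (fun x : ℝ => (x : ℂ)) - z • (1 : Matrix n n ℂ))) * greenFunction A w := by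
    rw [Matrix.mul_sub, Matrix.sub_mul, Matrix.mul_assoc, mul_greenFunction hA hw,
      greenFunction_mul hA hz, Matrix.mul_one, Matrix.one_mul]
  rw [h1, sub_sub_sub_cancel_left, ← sub_smul, Matrix.mul_smul, Matrix.mul_one, Matrix.smul_mul]

/-- The Ward identity. -/
theorem sum_norm_sq_greenFunction (j : n) :
    ∑ k, ‖greenFunction A z j k‖ ^ 2 = (greenFunction A z j j).im / z.im := by
  set M := A.map (fun x : ℝ => (x : ℂ)) - z • (1 : Matrix n n ℂ) with hM
  set G := greenFunction A z with hG
  have hGM : G * M = 1 := greenFunction_mul hA hz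
  have hMG : M.conjTranspose * G.conjTranspose = 1 := by
    rw [← Matrix.conjTranspose_mul, hGM, Matrix.conjTranspose_one]
  have h1 : G - G.conjTranspose = G * (M.conjTranspose - M) * G.conjTranspose := by
    rw [Matrix.mul_sub, Matrix.sub_mul, Matrix.mul_assoc, hMG, hGM, Matrix.mul_one,
      Matrix.one_mul]
  have h2 : M.conjTranspose - M = (z - star z) • (1 : Matrix n n ℂ) := by
    ext a b
    by_cases h : a = b <;>
      simp [hM, hA.apply, h]
  rw [h2, Matrix.mul_smul, Matrix.mul_one, Matrix.smul_mul] at h1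
  have h3 := congrArg Complex.im (congrFun (congrFun h1 j) j)
  have h4 : (G * G.conjTranspose) j j = ((∑ k, ‖G j k‖ ^ 2 : ℝ) : ℂ) := by
    simp [Matrix.mul_apply, Complex.mul_conj, Complex.normSq_eq_norm_sq]
  rw [Matrix.smul_apply, h4] at h3
  simp only [Matrix.sub_apply, Matrix.conjTranspose_apply, Complex.sub_im, smul_eq_mul,
    Complex.mul_im, Complex.ofReal_im, Complex.ofReal_re, RCLike.star_def, Complex.conj_im,
    mul_zero, zero_add, sub_neg_eq_add] at h3
  rw [eq_div_iff hz.ne']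
  linarith

theorem sum_norm_sq_greenFunction_le {b : ℝ} (j : n) (hb : ‖greenFunction A z j j‖ ≤ b) :
    ∑ k, ‖greenFunction A z j k‖ ^ 2 ≤ b / z.im := by
  rw [sum_norm_sq_greenFunction hA hz]
  gcongr
  exact (Complex.im_le_norm _).trans hb

/-- The Ward identity bounds the square of the diagonal entry by its norm over Im z, which settles
the diagonal; applied once more it gives the other entries. -/
theorem norm_greenFunction_le (j k : n) : ‖greenFunction A z j k‖ ≤ 1 / z.im := by
  have key : ∀ k, ‖greenFunction A z j k‖ ^ 2 ≤ ‖greenFunction A z j j‖ / z.im := fun k =>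
    (Finset.single_le_sum (f := fun k => ‖greenFunction A z j k‖ ^ 2)
      (fun _ _ => by positivity) (Finset.mem_univ k)).trans
      (sum_norm_sq_greenFunction_le hA hz j le_rfl)
  have h1 : ‖greenFunction A z j j‖ ≤ 1 / z.im := by
    by_contra h
    push Not at h
    have h0 : 0 < ‖greenFunction A z j j‖ := lt_trans (by positivity) h
    have := key j
    rw [pow_two, div_eq_mul_one_div] at this
    exact absurd (le_of_mul_le_mul_left this h0) (not_le.2 h)
  refine abs_le_of_sq_le_sq' ?_ (by positivity) |>.2
  refine (key k).trans ?_
  rw [pow_two]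
  calc _ = ‖greenFunction A z j j‖ * (1 / z.im) := by ring
    _ ≤ _ := by gcongr

/-- Halving the imaginary part of the spectral parameter at most doubles the Green function. -/
theorem norm_greenFunction_le_two_mul {w : ℂ} (hw : w.im = 2 * z.im) (hre : w.re = z.re) {b : ℝ}
    {j k : n} (hj : ‖greenFunction A w j j‖ ≤ b) (hk : ‖greenFunction A w k k‖ ≤ b)
    (hjk : ‖greenFunction A w j k‖ ≤ b) : ‖greenFunction A z j k‖ ≤ 2 * b := by
  have hw0 : 0 < w.im := by rw [hw]; positivity
  have hb : 0 ≤ b := (norm_nonneg _).trans hj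
  have hzw : ‖z - w‖ = z.im := by
    have : z - w = ((-z.im : ℝ) : ℂ) * Complex.I := by
      apply Complex.ext <;> simp [hw, hre]; ring
    rw [this]
    simp [abs_of_pos hz]
  -- Resolvent identity, then AM-GM with weights 1/4 and 1, then the Ward identity at both points.
  -- The unknown diagonal entry at z appears with coefficient 1/4 only, so for j = k it can be
  -- absorbed on the left.
  have main : ∀ {j k : n}, ‖greenFunction A w k k‖ ≤ b → ‖greenFunction A w j k‖ ≤ b →
      ∀ c : ℝ, ‖greenFunction A z j j‖ ≤ c → ‖greenFunction A z j k‖ ≤ b + (c / 4 + b / 2) := by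
    intro j k hk hjk c hc
    have h1 := congrFun (congrFun (greenFunction_sub hA hz hw0) j) k
    rw [Matrix.sub_apply, Matrix.smul_apply, sub_eq_iff_eq_add', Matrix.mul_apply] at h1
    rw [h1]
    refine (norm_add_le _ _).trans (add_le_add hjk ?_)
    rw [norm_smul, hzw]
    have h2 : ‖∑ l, greenFunction A z j l * greenFunction A w l k‖ ≤
        ∑ l, ((‖greenFunction A z j l‖ ^ 2) / 4 + ‖greenFunction A w k l‖ ^ 2) := by
      refine (norm_sum_le _ _).trans (Finset.sum_le_sum fun l _ => ?_)
      rw [norm_mul, greenFunction_symm hA l k]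
      nlinarith [sq_nonneg (‖greenFunction A z j l‖ / 2 - ‖greenFunction A w k l‖)]
    rw [Finset.sum_add_distrib, ← Finset.sum_div] at h2
    have h3 := sum_norm_sq_greenFunction_le hA hz j hc
    have h4 := sum_norm_sq_greenFunction_le hA hw0 k hk
    calc _ ≤ z.im * (c / z.im / 4 + b / w.im) := by gcongr; linarith
      _ = _ := by rw [hw]; field_simp
  have hjj : ‖greenFunction A z j j‖ ≤ 2 * b := by
    have := main hj hj _ le_rfl
    linarith
  have := main hk hjk _ hjj
  linarith

/-- Entries of an eigenvector are controlled by the diagonal of the Green function. -/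
theorem sq_eigenvector_le {lam : ℝ} {u : n → ℝ} (hu : A.mulVec u = lam • u)
    (h1 : ∑ i, u i ^ 2 = 1) (hl : |lam - z.re| ≤ z.im) {b : ℝ} (i : n)
    (hb : ‖greenFunction A z i i‖ ≤ b) : u i ^ 2 ≤ 2 * z.im * b := by
  -- Apply the resolvent to (A - z)u = (λ - z)u; Cauchy-Schwarz and the Ward identity follow.
  have h2 : (u i : ℂ) = ∑ l, greenFunction A z i l * (((lam : ℂ) - z) * (u l : ℂ)) := by
    refine eq_sum_greenFunction hA hz (h := fun l => (u l : ℂ)) (fun j => ?_) i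
    have := congrFun hu j
    simp only [Matrix.mulVec, dotProduct, Pi.smul_apply, smul_eq_mul] at this
    have h3 : ∑ l, (A j l : ℂ) * (u l : ℂ) = (lam : ℂ) * u j := by
      exact_mod_cast this
    rw [h3]; ring
  have h3 : |u i| ≤ ‖(lam : ℂ) - z‖ * ∑ l, ‖greenFunction A z i l‖ * |u l| := by
    have h4 : |u i| = ‖(u i : ℂ)‖ := by simp
    rw [h4, h2]
    refine (norm_sum_le _ _).trans ?_
    rw [Finset.mul_sum]
    refine Finset.sum_le_sum fun l _ => le_of_eq ?_
    rw [norm_mul, norm_mul, Complex.norm_real, Real.norm_eq_abs]; ring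
  have h4 : (∑ l, ‖greenFunction A z i l‖ * |u l|) ^ 2 ≤ b / z.im := by
    refine (Finset.sum_mul_sq_le_sq_mul_sq _ _ _).trans ?_
    simp only [sq_abs, h1, mul_one]
    exact sum_norm_sq_greenFunction_le hA hz i hb
  have h5 : ‖(lam : ℂ) - z‖ ^ 2 ≤ 2 * z.im ^ 2 := by
    rw [← Complex.normSq_eq_norm_sq, Complex.normSq_apply]
    have := sq_le_sq' (abs_le.1 hl).1 (abs_le.1 hl).2
    simp; nlinarith
  calc u i ^ 2 = |u i| ^ 2 := (sq_abs _).symm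
    _ ≤ (‖(lam : ℂ) - z‖ * ∑ l, ‖greenFunction A z i l‖ * |u l|) ^ 2 := by gcongr
    _ = ‖(lam : ℂ) - z‖ ^ 2 * (∑ l, ‖greenFunction A z i l‖ * |u l|) ^ 2 := by ring
    _ ≤ 2 * z.im ^ 2 * (b / z.im) := by gcongr
    _ = _ := by field_simp

end Green

/-! ### Removing one vertex: Schur's complement formula and the minor's Green function. -/

section Schur

variable {n : Type*} [Fintype n] [DecidableEq n]

theorem sum_isolate_mul (A : Matrix n n ℝ) (i : n) (h : n → ℂ) (j : n) :
    ∑ l, (isolate A i j l : ℂ) * h l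
      = if j = i then 0 else ∑ l, (A j l : ℂ) * h l - A j i * h i := by
  split_ifs with hj
  · simp [isolate, hj]
  · rw [eq_sub_iff_add_eq, ← Finset.sum_erase_add _ _ (Finset.mem_univ i),
      ← Finset.sum_erase_add Finset.univ (fun l => (A j l : ℂ) * h l) (Finset.mem_univ i)]
    simp only [isolate, or_true, if_true, Complex.ofReal_zero, zero_mul, add_zero]
    congr 1
    refine Finset.sum_congr rfl fun l hl => ?_
    simp [hj, Finset.ne_of_mem_erase hl]

variable {A : Matrix n n ℝ} (hA : A.IsSymm) {z : ℂ} (hz : 0 < z.im) (i : n)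

/-- The image of the `i`-th row of `A` under the Green function of the `i`-th minor. -/
noncomputable def minorRow (A : Matrix n n ℝ) (z : ℂ) (i j : n) : ℂ :=
  ∑ l, greenFunction (isolate A i) z j l * (offDiagRow A i l : ℂ)

include hA hz

theorem greenFunction_isolate_self (j : n) :
    greenFunction (isolate A i) z j i = if j = i then -1 / z else 0 := by
  have hz0 : z ≠ 0 := fun h => by simp [h] at hz
  have := eq_sum_greenFunction (isolate_isSymm hA i) hz (h := fun l => if l = i then -1 / z else 0)
    (c := fun l => if l = i then 1 else 0) (fun l => ?_) j
  · simpa using this.symm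
  · rw [sum_isolate_mul]
    by_cases hl : l = i
    · simp [hl]; field_simp
    · simp [hl]

/-- A column of the full Green function solves the linear system of the isolated matrix with a right
side corrected by the i-th row, so applying the isolated Green function expresses it. All identities
for minors are read off from this one. -/
theorem greenFunction_column (k j : n) :
    greenFunction A z j k = (if k = i then 0 else greenFunction (isolate A i) z j k)
      - greenFunction A z i k * minorRow A z i j + if j = i then greenFunction A z i k else 0 := by
  have hz0 : z ≠ 0 := fun h => by simp [h] at hz
  have := eq_sum_greenFunction (isolate_isSymm hA i) hz (h := fun l => greenFunction A z l k)
    (c := fun l => (if l = k then (if k = i then 0 else 1) else 0)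
      - greenFunction A z i k * offDiagRow A i l
      - if l = i then z * greenFunction A z i k else 0) (fun l => ?_) j
  · rw [this]
    simp only [mul_sub, Finset.sum_sub_distrib, mul_ite, mul_zero, Finset.sum_ite_eq',
      Finset.mem_univ, if_true, greenFunction_isolate_self hA hz, minorRow, Finset.mul_sum, mul_one]
    have e1 : ∀ a b c c' : ℂ, c = -c' → a - b - c = a - b + c' := by
      intros a b c c' h; rw [h]; ring
    refine Eq.trans (e1 _ _ _ (if j = i then greenFunction A z i k else 0) ?_) ?_
    · split_ifs
      · field_simp
      · simp
    · congr 2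
      exact Finset.sum_congr rfl fun l _ => by ring
  · rw [sum_isolate_mul]
    by_cases hl : l = i
    · subst hl
      by_cases hk : k = l
      · simp [hk, offDiagRow]
      · simp [offDiagRow, Ne.symm hk]
    · have h1 := sum_mul_greenFunction hA hz l k
      simp only [hl, if_false, offDiagRow, sub_zero]
      rw [hA.apply i l]
      by_cases hk : l = k
      · subst hk
        simp only [hl, if_false, if_true] at h1 ⊢
        linear_combination h1
      · simp only [hk, if_false] at h1 ⊢
        linear_combination h1

theorem greenFunction_off_diag {j : n} (hj : j ≠ i) :
    greenFunction A z j i = - greenFunction A z i i * minorRow A z i j := by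
  rw [greenFunction_column hA hz i i j]
  simp [hj]

theorem greenFunction_minor {j k : n} (hj : j ≠ i) (hk : k ≠ i) :
    greenFunction (isolate A i) z j k
      = greenFunction A z j k - greenFunction A z i i * minorRow A z i k * minorRow A z i j := by
  have h := greenFunction_column hA hz i k j
  rw [greenFunction_symm hA i k, greenFunction_off_diag hA hz i hk] at h
  simp only [hj, hk, if_false] at h
  rw [h]; ring

/-- Schur's complement formula. -/
theorem greenFunction_schur :
    greenFunction A z i i *
      (A i i - z - ∑ j, (offDiagRow A i j : ℂ) * minorRow A z i j) = 1 := by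
  have h := sum_mul_greenFunction hA hz i i
  rw [if_pos rfl] at h
  have h1 : ∑ l, (A i l : ℂ) * greenFunction A z l i = A i i * greenFunction A z i i
      - greenFunction A z i i * ∑ j, (offDiagRow A i j : ℂ) * minorRow A z i j := by
    rw [← Finset.add_sum_erase _ _ (Finset.mem_univ i),
      ← Finset.add_sum_erase Finset.univ (fun j => (offDiagRow A i j : ℂ) * minorRow A z i j)
        (Finset.mem_univ i)]
    have h2 : offDiagRow A i i = 0 := by simp [offDiagRow]
    rw [h2, Complex.ofReal_zero, zero_mul, zero_add, Finset.mul_sum, sub_eq_add_neg,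
      ← Finset.sum_neg_distrib]
    congr 1
    refine Finset.sum_congr rfl fun l hl => ?_
    have hl := Finset.ne_of_mem_erase hl
    rw [greenFunction_off_diag hA hz i hl]
    simp only [offDiagRow, hl, if_false]
    ring
  rw [h1] at h
  linear_combination h

end Schur

/-! ### Finite product Bernoulli measures as weighted sums. -/

section BernoulliProduct

variable {ι : Type*} [Fintype ι]

/-- The probability of the outcome `x` of independent Bernoulli variables with means `q`. -/
noncomputable def bernoulliWeight (q : ι → ℝ) (x : ι → Bool) : ℝ :=
  ∏ e, if x e then q e else 1 - q e

variable [DecidableEq ι]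

/-- The expectation with respect to independent Bernoulli variables with means `q`. -/
noncomputable def bernoulliExp (q : ι → ℝ) (f : (ι → Bool) → ℝ) : ℝ :=
  ∑ x, bernoulliWeight q x * f x

/-- The probability of an event under independent Bernoulli variables with means `q`. -/
noncomputable def bernoulliProb (q : ι → ℝ) (S : Set (ι → Bool)) : ℝ :=
  bernoulliExp q (S.indicator 1)

omit [DecidableEq ι] in
theorem bernoulliWeight_nonneg {q : ι → ℝ} (h0 : ∀ e, 0 ≤ q e) (h1 : ∀ e, q e ≤ 1)
    (x : ι → Bool) : 0 ≤ bernoulliWeight q x := by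
  refine Finset.prod_nonneg fun e _ => ?_
  split_ifs
  · exact h0 e
  · linarith [h1 e]

theorem bernoulliExp_prod (q : ι → ℝ) (f : ι → Bool → ℝ) :
    bernoulliExp q (fun x => ∏ e, f e (x e)) = ∏ e, (q e * f e true + (1 - q e) * f e false) := by
  have h := Finset.prod_univ_sum (fun _ : ι => (Finset.univ : Finset Bool))
    (fun e b => (if b then q e else 1 - q e) * f e b)
  simp only [Fintype.univ_bool, Finset.mem_singleton, Bool.true_eq_false,
    not_false_eq_true, Finset.sum_insert, Finset.sum_singleton, if_true, Bool.false_eq_true,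
    if_false] at h
  rw [h]
  refine Finset.sum_congr rfl fun x _ => ?_
  rw [bernoulliWeight, ← Finset.prod_mul_distrib]

theorem bernoulliExp_const_one (q : ι → ℝ) : bernoulliExp q (fun _ => 1) = 1 := by
  simpa using bernoulliExp_prod q (fun _ _ => 1)

theorem bernoulliExp_mul_left (q : ι → ℝ) (c : ℝ) (f : (ι → Bool) → ℝ) :
    bernoulliExp q (fun x => c * f x) = c * bernoulliExp q f := by
  rw [bernoulliExp, bernoulliExp, Finset.mul_sum]
  exact Finset.sum_congr rfl fun x _ => by ring

theorem bernoulliExp_comp_equiv {q : ι → ℝ} (σ : ι ≃ ι) (hq : ∀ e, q (σ e) = q e)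
    (f : (ι → Bool) → ℝ) : bernoulliExp q (fun x => f (x ∘ σ)) = bernoulliExp q f := by
  refine Fintype.sum_equiv (Equiv.arrowCongr σ.symm (Equiv.refl Bool)) _ _ fun x => ?_
  have hx : (Equiv.arrowCongr σ.symm (Equiv.refl Bool)) x = x ∘ σ := rfl
  rw [hx]
  congr 1
  refine (Fintype.prod_equiv σ _ _ fun e => ?_).symm
  simp [hq]

variable {q : ι → ℝ} (h0 : ∀ e, 0 ≤ q e) (h1 : ∀ e, q e ≤ 1)
include h0 h1

theorem bernoulliExp_mono {f g : (ι → Bool) → ℝ} (h : ∀ x, f x ≤ g x) :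
    bernoulliExp q f ≤ bernoulliExp q g :=
  Finset.sum_le_sum fun x _ => mul_le_mul_of_nonneg_left (h x) (bernoulliWeight_nonneg h0 h1 x)

theorem bernoulliProb_mono {S T : Set (ι → Bool)} (h : S ⊆ T) :
    bernoulliProb q S ≤ bernoulliProb q T :=
  bernoulliExp_mono h0 h1 fun x =>
    Set.indicator_le_indicator_of_subset h (fun _ => zero_le_one) x

theorem bernoulliProb_le_exp {S : Set (ι → Bool)} {f : (ι → Bool) → ℝ}
    (hf : ∀ x, 0 ≤ f x) (hS : ∀ x ∈ S, 1 ≤ f x) : bernoulliProb q S ≤ bernoulliExp q f :=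
  bernoulliExp_mono h0 h1 fun x => by
    by_cases hx : x ∈ S
    · simpa [hx] using hS x hx
    · simpa [hx] using hf x

theorem bernoulliProb_union_le (S T : Set (ι → Bool)) :
    bernoulliProb q (S ∪ T) ≤ bernoulliProb q S + bernoulliProb q T := by
  have : bernoulliProb q S + bernoulliProb q T
      = bernoulliExp q (fun x => S.indicator 1 x + T.indicator 1 x) := by
    simp only [bernoulliProb, bernoulliExp, mul_add, Finset.sum_add_distrib]
  rw [this]
  refine bernoulliProb_le_exp h0 h1 (fun x => ?_) fun x hx => ?_
  · exact add_nonneg (Set.indicator_nonneg (fun _ _ => zero_le_one) x)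
      (Set.indicator_nonneg (fun _ _ => zero_le_one) x)
  · rcases hx with hx | hx
    · have := Set.indicator_nonneg (s := T) (f := (1 : (ι → Bool) → ℝ)) (fun _ _ => zero_le_one) x
      simp [hx]; exact this
    · have := Set.indicator_nonneg (s := S) (f := (1 : (ι → Bool) → ℝ)) (fun _ _ => zero_le_one) x
      simp [hx]; exact this

theorem bernoulliProb_biUnion_le {κ : Type*} (s : Finset κ) (S : κ → Set (ι → Bool)) :
    bernoulliProb q (⋃ i ∈ s, S i) ≤ ∑ i ∈ s, bernoulliProb q (S i) := by
  classical
  induction s using Finset.induction_on with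
  | empty => simp [bernoulliProb, bernoulliExp]
  | insert a s ha ih =>
    rw [Finset.set_biUnion_insert, Finset.sum_insert ha]
    exact (bernoulliProb_union_le h0 h1 _ _).trans (add_le_add le_rfl ih)

omit h0 h1 in
theorem bernoulliProb_add_compl (S : Set (ι → Bool)) :
    bernoulliProb q S + bernoulliProb q Sᶜ = 1 := by
  rw [← bernoulliExp_const_one q]
  simp only [bernoulliProb, bernoulliExp]
  rw [← Finset.sum_add_distrib]
  refine Finset.sum_congr rfl fun x _ => ?_
  rw [← mul_add]
  congr 1
  by_cases hx : x ∈ S <;> simp [hx]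

omit h0 h1 in
theorem bernoulliProb_forall_mem (p : ℝ) (T : Finset ι) :
    bernoulliProb (fun _ => p) {x | ∀ e ∈ T, x e = true} = p ^ T.card := by
  have h : ∀ x : ι → Bool, Set.indicator {x : ι → Bool | ∀ e ∈ T, x e = true} 1 x
      = ∏ e, if e ∈ T then (if x e then (1 : ℝ) else 0) else 1 := by
    intro x
    rw [Finset.prod_ite_mem, Finset.univ_inter, Finset.prod_ite_zero]
    simp [Set.indicator_apply]
  rw [bernoulliProb, funext h,
    bernoulliExp_prod _ (fun e b => if e ∈ T then (if b then (1 : ℝ) else 0) else 1)]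
  rw [← Finset.prod_const, ← Finset.univ_inter T, ← Finset.prod_ite_mem]
  refine Finset.prod_congr rfl fun e _ => ?_
  by_cases he : e ∈ T <;> simp [he]

end BernoulliProduct

/-! ### Exponential tail bounds for weighted Bernoulli sums. -/

section Chernoff

variable {ι : Type*} [Fintype ι] [DecidableEq ι]

theorem bernoulliProb_sum_gt_le {p : ℝ} (hp0 : 0 ≤ p) (hp1 : p ≤ 1) {b : ι → ℝ} {Γ t : ℝ}
    (hb : ∀ e, |b e| ≤ Γ) (ht : 0 ≤ t) (htΓ : t * Γ ≤ 1) (τ : ℝ) :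
    bernoulliProb (fun _ => p) {x : ι → Bool | τ < ∑ e, ((if x e then 1 else 0) - p) * b e}
      ≤ Real.exp (t ^ 2 * (p * Fintype.card ι) * Γ ^ 2 - t * τ) := by
  refine (bernoulliProb_le_exp (fun _ => hp0) (fun _ => hp1) (f := fun x =>
    Real.exp (- t * τ) * ∏ e, Real.exp (((if x e then 1 else 0) - p) * (t * b e)))
    (fun x => by positivity) fun x hx => ?_).trans ?_
  · rw [← Real.exp_sum, ← Real.exp_add, Real.one_le_exp_iff]
    have : ∑ e, ((if x e then 1 else 0) - p) * (t * b e)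
        = t * ∑ e, ((if x e then 1 else 0) - p) * b e := by
      rw [Finset.mul_sum]; exact Finset.sum_congr rfl fun e _ => by ring
    rw [this]
    have := mul_le_mul_of_nonneg_left (le_of_lt hx) ht
    linarith
  · rw [bernoulliExp_mul_left, bernoulliExp_prod _
      (fun e c => Real.exp (((if c then 1 else 0) - p) * (t * b e)))]
    -- The bound exp h - 1 - h ≤ h², valid for |h| ≤ 1, gives a centred Bernoulli exponential moment
    -- of at most exp(p h²).
    have key : ∀ e : ι, p * Real.exp (((if true then 1 else 0) - p) * (t * b e))
        + (1 - p) * Real.exp (((if false then 1 else 0) - p) * (t * b e))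
        ≤ Real.exp (p * (t ^ 2 * Γ ^ 2)) := by
      intro e
      have hG : 0 ≤ Γ := (abs_nonneg _).trans (hb e)
      have hh : |t * b e| ≤ t * Γ := by
        rw [abs_mul, abs_of_nonneg ht]; exact mul_le_mul_of_nonneg_left (hb e) ht
      set h := t * b e with hdef
      have h1 := (abs_le.1 (Real.abs_exp_sub_one_sub_id_le (hh.trans htΓ))).2
      have h2 : h ^ 2 ≤ t ^ 2 * Γ ^ 2 := by
        rw [← mul_pow]; exact sq_le_sq' (by linarith [(abs_le.1 hh).1]) (abs_le.1 hh).2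
      have e1 : p * Real.exp (((if true then 1 else 0) - p) * h)
          + (1 - p) * Real.exp (((if false then 1 else 0) - p) * h)
          = Real.exp (- p * h) * (1 + p * (Real.exp h - 1)) := by
        have : ((1 : ℝ) - p) * h = -p * h + h := by ring
        simp only [if_true, Bool.false_eq_true, if_false, zero_sub, this, Real.exp_add]
        ring
      rw [e1]
      calc _ ≤ Real.exp (- p * h) * Real.exp (p * (Real.exp h - 1)) := by
            gcongr
            linarith [Real.add_one_le_exp (p * (Real.exp h - 1))]
        _ = Real.exp (p * (Real.exp h - 1 - h)) := by
            rw [← Real.exp_add]; congr 1; ring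
        _ ≤ _ := by
            gcongr
            linarith
    calc _ ≤ Real.exp (- t * τ) * ∏ _e : ι, Real.exp (p * (t ^ 2 * Γ ^ 2)) := by
          refine mul_le_mul_of_nonneg_left (Finset.prod_le_prod (fun e _ => ?_) fun e _ => key e)
            (Real.exp_nonneg _)
          have : 0 ≤ 1 - p := by linarith
          positivity
      _ = _ := by
          rw [Finset.prod_const, Finset.card_univ, ← Real.exp_nat_mul, ← Real.exp_add]
          congr 1; ring

theorem bernoulliProb_abs_sum_gt_le {p : ℝ} (hp0 : 0 ≤ p) (hp1 : p ≤ 1) {b : ι → ℝ} {Γ t : ℝ}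
    (hb : ∀ e, |b e| ≤ Γ) (ht : 0 ≤ t) (htΓ : t * Γ ≤ 1) (τ : ℝ) :
    bernoulliProb (fun _ => p) {x : ι → Bool | τ < |∑ e, ((if x e then 1 else 0) - p) * b e|}
      ≤ 2 * Real.exp (t ^ 2 * (p * Fintype.card ι) * Γ ^ 2 - t * τ) := by
  have h1 := bernoulliProb_sum_gt_le hp0 hp1 hb ht htΓ τ
  have h2 := bernoulliProb_sum_gt_le hp0 hp1 (b := fun e => - b e) (by simpa using hb) ht htΓ τ
  refine (bernoulliProb_mono (fun _ => hp0) (fun _ => hp1) ?_).trans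
    ((bernoulliProb_union_le (fun _ => hp0) (fun _ => hp1) _ _).trans
      ((add_le_add h1 h2).trans (by linarith)))
  intro x hx
  rcases lt_abs.1 (show τ < |_| from hx) with h | h
  · exact Or.inl h
  · refine Or.inr ?_
    show τ < _
    simpa [Finset.sum_neg_distrib] using h

end Chernoff

/-! ### Resampling the edges at one vertex. -/

section Resample

variable {V : Type*} [Fintype V] [DecidableEq V]

/-- Replace the off-diagonal edges at the vertex `i` by those given by `ζ`. -/
def resampleRow (X : Sym2 V → Bool) (i : V) (ζ : V → Bool) : Sym2 V → Bool :=
  fun e => if h : i ∈ e ∧ ¬ e.IsDiag then ζ (Sym2.Mem.other' h.1) else X e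

omit [Fintype V] in
theorem resampleRow_row (X : Sym2 V → Bool) {i j : V} (ζ : V → Bool) (h : j ≠ i) :
    resampleRow X i ζ s(i, j) = ζ j := by
  have h1 : i ∈ s(i, j) ∧ ¬ (s(i, j)).IsDiag := ⟨Sym2.mem_mk_left _ _, by simpa using h.symm⟩
  rw [resampleRow, dif_pos h1]
  congr 1
  have := Sym2.other_spec' h1.1
  exact Sym2.congr_right.1 this

omit [Fintype V] in
theorem resampleRow_of_not (X : Sym2 V → Bool) {i : V} (ζ : V → Bool) {e : Sym2 V}
    (h : ¬ (i ∈ e ∧ ¬ e.IsDiag)) : resampleRow X i ζ e = X e := by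
  rw [resampleRow, dif_neg h]

theorem prod_sym2_eq (i : V) (F : Sym2 V → ℝ) :
    ∏ e, F e = (∏ j ∈ Finset.univ.erase i, F s(i, j)) *
      ∏ e with ¬ (i ∈ e ∧ ¬ e.IsDiag), F e := by
  rw [← Finset.prod_filter_mul_prod_filter_not Finset.univ (fun e : Sym2 V => i ∈ e ∧ ¬ e.IsDiag)]
  congr 1
  symm
  refine Finset.prod_nbij (fun j => s(i, j)) ?_ ?_ ?_ fun _ _ => rfl
  · intro j hj
    have := Finset.ne_of_mem_erase hj
    simp [this.symm]
  · intro j _ k _ h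
    exact Sym2.congr_right.1 h
  · intro e he
    simp only [Finset.coe_filter, Finset.mem_univ, true_and, Set.mem_ofPred_eq] at he
    refine ⟨Sym2.Mem.other' he.1, ?_, Sym2.other_spec' he.1⟩
    simp only [Finset.coe_erase, Finset.coe_univ, Set.mem_sdiff, Set.mem_univ, true_and,
      Set.mem_singleton_iff]
    intro h
    apply he.2
    rw [← Sym2.other_spec' he.1, h]
    simp

/-- Exchanging the off-diagonal row i of X with the independent copy ζ is a weight-preserving
involution of pairs. This replaces conditioning on the minor. -/
theorem bernoulliExp_resampleRow {q : Sym2 V → ℝ} {p : ℝ} (i : V) (hq : ∀ j, j ≠ i → q s(i, j) = p)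
    (f : (Sym2 V → Bool) → ℝ) :
    bernoulliExp q f = bernoulliExp q
      (fun X => bernoulliExp (fun _ : V => p) (fun ζ => f (resampleRow X i ζ))) := by
  -- The coordinate `ζ i` matches no off-diagonal edge and is left in place; the loop at i, whose
  -- probability may differ from p, is not exchanged.
  let Φ : (Sym2 V → Bool) × (V → Bool) → (Sym2 V → Bool) × (V → Bool) := fun a =>
    (resampleRow a.1 i a.2, fun j => if j = i then a.2 i else a.1 s(i, j))
  have hΦ : Function.Involutive Φ := by
    rintro ⟨X, ζ⟩
    refine Prod.ext ?_ ?_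
    · ext e
      by_cases h : i ∈ e ∧ ¬ e.IsDiag
      · obtain ⟨h1, h2⟩ := h
        obtain ⟨j, rfl⟩ := h1
        have hj : j ≠ i := by rintro rfl; simp at h2
        simp [Φ, resampleRow_row _ _ hj, hj]
      · simp [Φ, resampleRow_of_not _ _ h]
    · ext j
      by_cases hj : j = i
      · simp [Φ, hj]
      · simp [Φ, hj, resampleRow_row]
  have hw : ∀ a, bernoulliWeight q (Φ a).1 * bernoulliWeight (fun _ : V => p) (Φ a).2
      = bernoulliWeight q a.1 * bernoulliWeight (fun _ : V => p) a.2 := by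
    rintro ⟨X, ζ⟩
    simp only [bernoulliWeight, prod_sym2_eq i]
    rw [← Finset.prod_erase_mul Finset.univ _ (Finset.mem_univ i),
      ← Finset.prod_erase_mul Finset.univ (fun j => if ζ j then p else 1 - p) (Finset.mem_univ i)]
    have e1 : ∏ j ∈ Finset.univ.erase i, (if (Φ (X, ζ)).1 s(i, j) then q s(i, j)
        else 1 - q s(i, j)) = ∏ j ∈ Finset.univ.erase i, (if ζ j then p else 1 - p) :=
      Finset.prod_congr rfl fun j hj => by
        have hj := Finset.ne_of_mem_erase hj
        simp [Φ, resampleRow_row _ _ hj, hq j hj]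
    have e2 : ∏ j ∈ Finset.univ.erase i, (if (Φ (X, ζ)).2 j then p else 1 - p)
        = ∏ j ∈ Finset.univ.erase i, (if X s(i, j) then q s(i, j) else 1 - q s(i, j)) :=
      Finset.prod_congr rfl fun j hj => by
        have hj := Finset.ne_of_mem_erase hj
        simp [Φ, hj, hq j hj]
    have e3 : ∏ e with ¬ (i ∈ e ∧ ¬ e.IsDiag), (if (Φ (X, ζ)).1 e then q e else 1 - q e)
        = ∏ e with ¬ (i ∈ e ∧ ¬ e.IsDiag), (if X e then q e else 1 - q e) :=
      Finset.prod_congr rfl fun e he => by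
        rw [Finset.mem_filter] at he
        simp [Φ, resampleRow_of_not _ _ he.2]
    have e4 : (Φ (X, ζ)).2 i = ζ i := by simp [Φ]
    rw [e1, e2, e3, e4]
    ring
  have h1 : bernoulliExp q (fun X => bernoulliExp (fun _ : V => p) (fun ζ => f (resampleRow X i ζ)))
      = ∑ a : (Sym2 V → Bool) × (V → Bool),
        bernoulliWeight q a.1 * bernoulliWeight (fun _ : V => p) a.2 * f (Φ a).1 := by
    rw [Fintype.sum_prod_type]
    refine Finset.sum_congr rfl fun X _ => ?_
    simp only [bernoulliExp, Finset.mul_sum]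
    exact Finset.sum_congr rfl fun ζ _ => by simp [Φ, mul_assoc]
  rw [h1]
  have h2 : ∑ a : (Sym2 V → Bool) × (V → Bool),
        bernoulliWeight q a.1 * bernoulliWeight (fun _ : V => p) a.2 * f (Φ a).1
      = ∑ a : (Sym2 V → Bool) × (V → Bool),
        bernoulliWeight q a.1 * bernoulliWeight (fun _ : V => p) a.2 * f a.1 := by
    refine Fintype.sum_equiv hΦ.toPerm _ _ fun a => ?_
    rw [Function.Involutive.coe_toPerm, hw]
  rw [h2, Fintype.sum_prod_type]
  refine Finset.sum_congr rfl fun X _ => ?_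
  have h3 := bernoulliExp_const_one (fun _ : V => p)
  simp only [bernoulliExp, mul_one] at h3
  change _ = ∑ ζ : V → Bool, bernoulliWeight q X * bernoulliWeight (fun _ : V => p) ζ * f X
  rw [← Finset.sum_mul, ← Finset.mul_sum, h3, mul_one]

/-- An event which is unlikely for every resampling of the `i`-th row is unlikely. -/
theorem bernoulliProb_le_of_resampleRow {q : Sym2 V → ℝ} {p : ℝ} (h0 : ∀ e, 0 ≤ q e)
    (h1 : ∀ e, q e ≤ 1) (i : V) (hq : ∀ j, j ≠ i → q s(i, j) = p) (S : Set (Sym2 V → Bool)) {ε : ℝ}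
    (h : ∀ X, bernoulliProb (fun _ : V => p) {ζ | resampleRow X i ζ ∈ S} ≤ ε) :
    bernoulliProb q S ≤ ε := by
  rw [bernoulliProb, bernoulliExp_resampleRow i hq]
  calc _ ≤ bernoulliExp q (fun _ => ε * 1) := bernoulliExp_mono h0 h1 fun X => by
        rw [mul_one]; exact h X
    _ = ε := by rw [bernoulliExp_mul_left, bernoulliExp_const_one, mul_one]

end Resample

/-! ### Stars and matchings of a sparse graph inside a random vertex set. -/

section RandomSubset

variable {V : Type*} [Fintype V] [DecidableEq V]

/-- The random subset of `V` encoded by its indicator function. -/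
def selected (x : V → Bool) : Finset V := {j | x j = true}

omit [DecidableEq V] in
theorem mem_selected {x : V → Bool} {j : V} : j ∈ selected x ↔ x j = true := by
  simp [selected]

/-- The endpoints of a family of pairs. -/
def endpoints {m : ℕ} (v : Fin m → V × V) : Finset V :=
  Finset.univ.biUnion fun t => {(v t).1, (v t).2}

variable (bad : V → V → Prop) [∀ j k, Decidable (bad j k)]

/-- A random set is unlikely to contain many neighbours of the same vertex in a sparse graph. -/
theorem bernoulliProb_star_le {p b : ℝ} (hp0 : 0 ≤ p) (hp1 : p ≤ 1)
    (hb : ∀ j, ((Finset.univ.filter fun k => bad j k).card : ℝ) ≤ b) (l : ℕ) :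
    bernoulliProb (fun _ => p) {x : V → Bool | ∃ j, l ≤ ((selected x).filter (bad j)).card}
      ≤ Fintype.card V * (b * p) ^ l := by
  have hsub : {x : V → Bool | ∃ j, l ≤ ((selected x).filter (bad j)).card} ⊆
      ⋃ j ∈ (Finset.univ : Finset V),
        ⋃ T ∈ Finset.powersetCard l (Finset.univ.filter (bad j)),
          {x : V → Bool | ∀ e ∈ T, x e = true} := by
    rintro x ⟨j, hj⟩
    obtain ⟨T, hT, hc⟩ := Finset.exists_subset_card_eq hj
    simp only [Set.mem_iUnion]
    refine ⟨j, Finset.mem_univ j, T, ?_, fun e he => ?_⟩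
    · rw [Finset.mem_powersetCard]
      exact ⟨hT.trans (Finset.filter_subset_filter _ (Finset.subset_univ _)), hc⟩
    · exact mem_selected.1 (Finset.mem_filter.1 (hT he)).1
  refine (bernoulliProb_mono (fun _ => hp0) (fun _ => hp1) hsub).trans
    ((bernoulliProb_biUnion_le (fun _ => hp0) (fun _ => hp1) _ _).trans ?_)
  rw [← Finset.card_univ, ← nsmul_eq_mul]
  refine Finset.sum_le_card_nsmul _ _ _ fun j _ => ?_
  refine (bernoulliProb_biUnion_le (fun _ => hp0) (fun _ => hp1) _ _).trans ?_
  rw [Finset.sum_congr rfl fun T hT => by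
    rw [bernoulliProb_forall_mem, (Finset.mem_powersetCard.1 hT).2], Finset.sum_const,
    Finset.card_powersetCard, nsmul_eq_mul, mul_pow]
  gcongr
  calc _ ≤ (((Finset.univ.filter (bad j)).card ^ l : ℕ) : ℝ) := by
        exact_mod_cast Nat.choose_le_pow _ _
    _ ≤ _ := by push_cast; gcongr; exact hb j

/-- A random set is unlikely to contain a large matching of a sparse graph. -/
theorem bernoulliProb_matching_le {p b : ℝ} (hp0 : 0 ≤ p) (hp1 : p ≤ 1)
    (hb : ∀ j, ((Finset.univ.filter fun k => bad j k).card : ℝ) ≤ b) (m : ℕ) :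
    bernoulliProb (fun _ => p) {x : V → Bool | ∃ v : Fin m → V × V, (∀ t, bad (v t).1 (v t).2) ∧
        (endpoints v).card = 2 * m ∧ endpoints v ⊆ selected x}
      ≤ (Fintype.card V * b * p ^ 2) ^ m := by
  have hsub : {x : V → Bool | ∃ v : Fin m → V × V, (∀ t, bad (v t).1 (v t).2) ∧
        (endpoints v).card = 2 * m ∧ endpoints v ⊆ selected x} ⊆
      ⋃ v ∈ (Finset.univ : Finset (Fin m → V × V)).filter (fun v =>
          (∀ t, bad (v t).1 (v t).2) ∧ (endpoints v).card = 2 * m),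
        {x : V → Bool | ∀ e ∈ endpoints v, x e = true} := by
    rintro x ⟨v, hv, hc, hs⟩
    simp only [Set.mem_iUnion]
    exact ⟨v, by simp [hc]; exact fun t => hv t, fun e he => mem_selected.1 (hs he)⟩
  refine (bernoulliProb_mono (fun _ => hp0) (fun _ => hp1) hsub).trans
    ((bernoulliProb_biUnion_le (fun _ => hp0) (fun _ => hp1) _ _).trans ?_)
  rw [Finset.sum_congr rfl fun v hv => by
    rw [bernoulliProb_forall_mem, (Finset.mem_filter.1 hv).2.2], Finset.sum_const, nsmul_eq_mul,
    mul_pow, pow_mul]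
  gcongr
  set B := (Finset.univ : Finset (V × V)).filter fun a => bad a.1 a.2 with hB
  have hBc : (B.card : ℝ) ≤ Fintype.card V * b := by
    have : B.card = ∑ j, (Finset.univ.filter fun k => bad j k).card := by
      rw [hB, Finset.card_filter, Fintype.sum_prod_type]
      exact Finset.sum_congr rfl fun j _ => (Finset.card_filter _ _).symm
    rw [this, Nat.cast_sum, ← Finset.card_univ, ← nsmul_eq_mul]
    exact Finset.sum_le_card_nsmul _ _ _ fun j _ => hb j
  have h2 : ((Finset.univ : Finset (Fin m → V × V)).filter (fun v =>
          (∀ t, bad (v t).1 (v t).2) ∧ (endpoints v).card = 2 * m)).card ≤ B.card ^ m := by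
    calc _ ≤ (Fintype.piFinset fun _ : Fin m => B).card := by
          refine Finset.card_le_card fun v hv => ?_
          rw [Fintype.mem_piFinset]
          intro t
          simpa [hB] using (Finset.mem_filter.1 hv).2.1 t
      _ = _ := by simp
  calc _ ≤ ((B.card ^ m : ℕ) : ℝ) := by exact_mod_cast h2
    _ ≤ _ := by push_cast; gcongr

omit [Fintype V] in
/-- A graph with many edges and small degrees contains a large matching. -/
theorem exists_matching (hsymm : ∀ j k, bad j k → bad k j) {l : ℕ} (m : ℕ) :
    ∀ S : Finset V, (∀ j ∈ S, (S.filter (bad j)).card ≤ l) →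
      4 * l * m < (S.offDiag.filter fun a => bad a.1 a.2).card →
      ∃ v : Fin m → V × V, (∀ t, bad (v t).1 (v t).2) ∧ (endpoints v).card = 2 * m ∧
        endpoints v ⊆ S := by
  induction m with
  | zero => intro S _ _; exact ⟨Fin.elim0, fun t => t.elim0, by simp [endpoints], by simp [endpoints]⟩
  | succ m ih =>
    intro S hS hlt
    obtain ⟨⟨j, k⟩, hjk⟩ := Finset.card_pos.1 (lt_of_le_of_lt (Nat.zero_le _) hlt)
    simp only [Finset.mem_filter, Finset.mem_offDiag] at hjk
    obtain ⟨⟨hj, hk, hne⟩, hbad⟩ := hjk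
    -- Greedy step: ordered bad pairs meeting {j, k} lie in four stars of size at most l, so
    -- deleting j and k costs at most 4l of them.
    have hcov : S.offDiag.filter (fun a => bad a.1 a.2) ⊆
        (((S \ {j, k}).offDiag.filter fun a => bad a.1 a.2) ∪
        (((S.filter (bad j)).image fun a => (j, a)) ∪ ((S.filter (bad k)).image fun a => (k, a)))) ∪
        (((S.filter (bad j)).image fun a => (a, j)) ∪
          ((S.filter (bad k)).image fun a => (a, k))) := by
      rintro ⟨a, c⟩ h
      simp only [Finset.mem_filter, Finset.mem_offDiag] at h
      obtain ⟨⟨ha, hc, hac⟩, hb⟩ := h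
      have hb' := hsymm _ _ hb
      simp only [Finset.mem_union, Finset.mem_filter, Finset.mem_offDiag, Finset.mem_sdiff,
        Finset.mem_insert, Finset.mem_singleton, Finset.mem_image, Prod.mk.injEq]
      by_cases h1 : a = j
      · subst h1; exact Or.inl (Or.inr (Or.inl ⟨c, ⟨hc, hb⟩, rfl, rfl⟩))
      by_cases h2 : a = k
      · subst h2; exact Or.inl (Or.inr (Or.inr ⟨c, ⟨hc, hb⟩, rfl, rfl⟩))
      by_cases h3 : c = j
      · subst h3; exact Or.inr (Or.inl ⟨a, ⟨ha, hb'⟩, rfl, rfl⟩)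
      by_cases h4 : c = k
      · subst h4; exact Or.inr (Or.inr ⟨a, ⟨ha, hb'⟩, rfl, rfl⟩)
      exact Or.inl (Or.inl ⟨⟨⟨ha, by tauto⟩, ⟨hc, by tauto⟩, hac⟩, hb⟩)
    have hle := Finset.card_le_card hcov
    have u1 := Finset.card_union_le (((S \ {j, k}).offDiag.filter fun a => bad a.1 a.2) ∪
        (((S.filter (bad j)).image fun a => (j, a)) ∪ ((S.filter (bad k)).image fun a => (k, a))))
        (((S.filter (bad j)).image fun a => (a, j)) ∪ ((S.filter (bad k)).image fun a => (a, k)))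
    have u2 := Finset.card_union_le ((S \ {j, k}).offDiag.filter fun a => bad a.1 a.2)
      (((S.filter (bad j)).image fun a => (j, a)) ∪ ((S.filter (bad k)).image fun a => (k, a)))
    have u3 := Finset.card_union_le ((S.filter (bad j)).image fun a => (j, a))
      ((S.filter (bad k)).image fun a => (k, a))
    have u4 := Finset.card_union_le ((S.filter (bad j)).image fun a => (a, j))
      ((S.filter (bad k)).image fun a => (a, k))
    have i1 := Finset.card_image_le (s := S.filter (bad j)) (f := fun a => (j, a))
    have i2 := Finset.card_image_le (s := S.filter (bad k)) (f := fun a => (k, a))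
    have i3 := Finset.card_image_le (s := S.filter (bad j)) (f := fun a => (a, j))
    have i4 := Finset.card_image_le (s := S.filter (bad k)) (f := fun a => (a, k))
    have d1 := hS j hj
    have d2 := hS k hk
    have hlt' : 4 * l * m < ((S \ {j, k}).offDiag.filter fun a => bad a.1 a.2).card := by
      have : 4 * l * (m + 1) = 4 * l * m + 4 * l := by ring
      omega
    obtain ⟨v, hv, hc, hs⟩ := ih (S \ {j, k}) (fun a ha => by
      refine le_trans (Finset.card_le_card ?_) (hS a (Finset.mem_sdiff.1 ha).1)
      exact Finset.filter_subset_filter _ Finset.sdiff_subset) hlt'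
    have hE : endpoints (Fin.cons (j, k) v : Fin (m + 1) → V × V) = {j, k} ∪ endpoints v := by
      ext a
      simp [endpoints, Fin.exists_fin_succ, or_assoc]
    refine ⟨Fin.cons (j, k) v, fun t => ?_, ?_, ?_⟩
    · refine Fin.cases ?_ (fun t => ?_) t
      · simpa using hbad
      · simpa using hv t
    · rw [hE, Finset.card_union_of_disjoint, hc, Finset.card_pair hne]
      · ring
      · exact (Finset.subset_sdiff.1 hs).2.symm
    · rw [hE]
      refine Finset.union_subset ?_ (hs.trans Finset.sdiff_subset)
      intro a ha
      simp only [Finset.mem_insert, Finset.mem_singleton] at ha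
      rcases ha with rfl | rfl <;> assumption

end RandomSubset

/-! ### Linear and quadratic forms in a random row. -/

section TypicalRow

variable {V : Type*} [Fintype V] [DecidableEq V]

/-- The linear and quadratic forms in a random `0`-`1` vector `x` with coefficients `R` are close to
their typical values. -/
structure IsTypicalRow (R : V → V → ℂ) (p a₁ a₂ a₃ : ℝ) (x : V → Bool) : Prop where
  diag : ‖∑ j, ((if x j then 1 else 0 : ℂ) - p) * R j j‖ ≤ a₁
  offDiag : ‖∑ a ∈ (selected x).offDiag, R a.1 a.2‖ ≤ a₂
  linear : ∀ j, ‖∑ k ∈ selected x, R j k‖ ≤ a₃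

omit [Fintype V] [DecidableEq V] in
theorem norm_sum_le_of_card_filter {κ : Type*} (s : Finset κ) (f : κ → ℂ) {Γ δ : ℝ} (hδ : 0 ≤ δ)
    (hf : ∀ a ∈ s, ‖f a‖ ≤ Γ) [∀ a, Decidable (δ < ‖f a‖)] :
    ‖∑ a ∈ s, f a‖ ≤ (s.filter fun a => δ < ‖f a‖).card * Γ + δ * s.card := by
  rw [← Finset.sum_filter_add_sum_filter_not s (fun a => δ < ‖f a‖)]
  refine (norm_add_le _ _).trans (add_le_add ?_ ?_)
  · rw [← nsmul_eq_mul]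
    exact (norm_sum_le _ _).trans
      (Finset.sum_le_card_nsmul _ _ _ fun a ha => hf a (Finset.mem_filter.1 ha).1)
  · refine (norm_sum_le _ _).trans ((Finset.sum_le_card_nsmul _ _ δ fun a ha => ?_).trans ?_)
    · exact not_lt.1 (Finset.mem_filter.1 ha).2
    · rw [nsmul_eq_mul, mul_comm]
      gcongr
      exact Finset.filter_subset _ _

/-- Call a pair bad if its entry exceeds δ; the row sums of squares allow at most W/δ² bad
neighbours per vertex. Without stars of size l or matchings of size m, the selected set has at most
4lm ordered bad pairs, each costing Γ; all other entries cost δ. Only the diagonal needs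
cancellation, through Chernoff. -/
theorem bernoulliProb_not_isTypicalRow_le {p : ℝ} (hp0 : 0 ≤ p) (hp1 : p ≤ 1) {R : V → V → ℂ}
    {Γ W δ t : ℝ} (hsymm : ∀ j k, R j k = R k j) (hΓ : 1 ≤ Γ) (hR : ∀ j k, ‖R j k‖ ≤ Γ)
    (hW : ∀ j, ∑ k, ‖R j k‖ ^ 2 ≤ W) (hδ : 0 < δ) (ht : 0 ≤ t) (htΓ : t * Γ ≤ 1) (τ : ℝ)
    (l m : ℕ) :
    bernoulliProb (fun _ => p) {x : V → Bool | ¬ IsTypicalRow R p (2 * τ)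
        (4 * l * m * Γ + δ * (p * Fintype.card V + τ) ^ 2)
        (l * Γ + δ * (p * Fintype.card V + τ)) x}
      ≤ 6 * Real.exp (t ^ 2 * (p * Fintype.card V) * Γ ^ 2 - t * τ)
        + Fintype.card V * (W / δ ^ 2 * p) ^ l
        + (Fintype.card V * (W / δ ^ 2) * p ^ 2) ^ m := by
  classical
  set bad : V → V → Prop := fun j k => δ < ‖R j k‖ with hbad
  have hb : ∀ j, ((Finset.univ.filter fun k => bad j k).card : ℝ) ≤ W / δ ^ 2 := by
    intro j
    rw [le_div_iff₀ (by positivity), ← nsmul_eq_mul]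
    refine le_trans ?_ (hW j)
    refine (Finset.card_nsmul_le_sum _ (fun k => ‖R j k‖ ^ 2) _ fun k hk => ?_).trans
      (Finset.sum_le_sum_of_subset_of_nonneg (Finset.filter_subset _ _) fun _ _ _ => by positivity)
    have : δ < ‖R j k‖ := (Finset.mem_filter.1 hk).2
    gcongr
  set E₁ := {x : V → Bool | τ < |∑ j, ((if x j then 1 else 0) - p) * (R j j).re|}
  set E₂ := {x : V → Bool | τ < |∑ j, ((if x j then 1 else 0) - p) * (R j j).im|}
  -- Unit coefficients control the size of the selected set; the same Chernoff bound applies because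
  -- Γ ≥ 1.
  set E₃ := {x : V → Bool | τ < |∑ j, ((if x j then 1 else 0) - p) * 1|}
  set E₄ := {x : V → Bool | ∃ j, l ≤ ((selected x).filter (bad j)).card}
  set E₅ := {x : V → Bool | ∃ v : Fin m → V × V, (∀ t, bad (v t).1 (v t).2) ∧
        (endpoints v).card = 2 * m ∧ endpoints v ⊆ selected x}
  have h₁ := bernoulliProb_abs_sum_gt_le hp0 hp1 (b := fun j => (R j j).re)
    (fun j => (Complex.abs_re_le_norm _).trans (hR j j)) ht htΓ τ
  have h₂ := bernoulliProb_abs_sum_gt_le hp0 hp1 (b := fun j => (R j j).im)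
    (fun j => (Complex.abs_im_le_norm _).trans (hR j j)) ht htΓ τ
  have h₃ := bernoulliProb_abs_sum_gt_le hp0 hp1 (b := fun _ : V => (1 : ℝ))
    (fun j => by simpa using hΓ) ht htΓ τ
  have h₄ := bernoulliProb_star_le bad hp0 hp1 hb l
  have h₅ := bernoulliProb_matching_le bad hp0 hp1 hb m
  have hU := fun S T => bernoulliProb_union_le (q := fun _ : V => p) (fun _ => hp0) (fun _ => hp1) S T
  have hsub : {x : V → Bool | ¬ IsTypicalRow R p (2 * τ)
        (4 * l * m * Γ + δ * (p * Fintype.card V + τ) ^ 2)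
        (l * Γ + δ * (p * Fintype.card V + τ)) x} ⊆ (((E₁ ∪ E₂) ∪ E₃) ∪ E₄) ∪ E₅ := by
    intro x hx
    by_contra hn
    simp only [Set.mem_union, not_or] at hn
    obtain ⟨⟨⟨⟨n₁, n₂⟩, n₃⟩, n₄⟩, n₅⟩ := hn
    have n₁ : |∑ j, ((if x j then 1 else 0) - p) * (R j j).re| ≤ τ := not_lt.1 n₁
    have n₂ : |∑ j, ((if x j then 1 else 0) - p) * (R j j).im| ≤ τ := not_lt.1 n₂
    have n₃ : |∑ j, ((if x j then 1 else 0) - p) * 1| ≤ τ := not_lt.1 n₃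
    have n₄ : ∀ j, ((selected x).filter (bad j)).card ≤ l := by
      intro j
      by_contra hc
      exact n₄ ⟨j, (not_le.1 hc).le⟩
    have hcard : ((selected x).card : ℝ) ≤ p * Fintype.card V + τ := by
      have h : ∑ j, ((if x j then 1 else 0) - p) * 1 = ((selected x).card : ℝ)
          - p * Fintype.card V := by
        simp [Finset.sum_sub_distrib, selected, mul_comm]
      rw [h] at n₃
      linarith [(abs_le.1 n₃).2]
    have hG0 : 0 ≤ Γ := by linarith
    apply hx
    refine ⟨?_, ?_, fun j => ?_⟩
    · refine (Complex.norm_le_abs_re_add_abs_im _).trans ?_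
      have e1 : (∑ j, ((if x j then 1 else 0 : ℂ) - p) * R j j).re
          = ∑ j, ((if x j then 1 else 0) - p) * (R j j).re := by
        rw [Complex.re_sum]
        refine Finset.sum_congr rfl fun j _ => ?_
        split_ifs <;> simp
      have e2 : (∑ j, ((if x j then 1 else 0 : ℂ) - p) * R j j).im
          = ∑ j, ((if x j then 1 else 0) - p) * (R j j).im := by
        rw [Complex.im_sum]
        refine Finset.sum_congr rfl fun j _ => ?_
        split_ifs <;> simp
      rw [e1, e2]
      linarith
    · refine (norm_sum_le_of_card_filter _ (fun a : V × V => R a.1 a.2) hδ.le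
        (fun a _ => hR _ _)).trans ?_
      have c1 : (((selected x).offDiag.filter fun a => bad a.1 a.2).card : ℝ) ≤ 4 * l * m := by
        have : ((selected x).offDiag.filter fun a => bad a.1 a.2).card ≤ 4 * l * m := by
          by_contra hc
          exact n₅ (exists_matching bad (fun j k h => by
            simp only [hbad] at h ⊢; rwa [hsymm]) m _ (fun j _ => n₄ j) (not_le.1 hc))
        exact_mod_cast this
      have c2 : ((selected x).offDiag.card : ℝ) ≤ (p * Fintype.card V + τ) ^ 2 := by
        have : (selected x).offDiag.card ≤ (selected x).card ^ 2 := by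
          rw [Finset.offDiag_card, pow_two]; exact Nat.sub_le _ _
        calc ((selected x).offDiag.card : ℝ) ≤ ((selected x).card : ℝ) ^ 2 := by exact_mod_cast this
          _ ≤ _ := by gcongr
      exact add_le_add (mul_le_mul_of_nonneg_right c1 hG0) (mul_le_mul_of_nonneg_left c2 hδ.le)
    · refine (norm_sum_le_of_card_filter _ (fun k => R j k) hδ.le
        (fun a _ => hR _ _)).trans ?_
      have c1 : (((selected x).filter fun k => bad j k).card : ℝ) ≤ l := by exact_mod_cast n₄ j
      exact add_le_add (mul_le_mul_of_nonneg_right c1 hG0) (mul_le_mul_of_nonneg_left hcard hδ.le)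
  refine (bernoulliProb_mono (fun _ => hp0) (fun _ => hp1) hsub).trans ?_
  have := hU (((E₁ ∪ E₂) ∪ E₃) ∪ E₄) E₅
  have := hU ((E₁ ∪ E₂) ∪ E₃) E₄
  have := hU (E₁ ∪ E₂) E₃
  have := hU E₁ E₂
  linarith

end TypicalRow

/-! ### The self-consistent equation and one bootstrap step. -/

section MinorGreen

variable {n : Type*} [Fintype n] [DecidableEq n]

/-- The Green function of the `i`-th minor, extended by zero. -/
noncomputable def minorGreen (A : Matrix n n ℝ) (z : ℂ) (i j k : n) : ℂ :=
  if j = i ∨ k = i then 0 else greenFunction (isolate A i) z j k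

/-- All entries of the Green functions of `A` and of its minors are bounded by `b`. -/
def GreenBounded (A : Matrix n n ℝ) (z : ℂ) (b : ℝ) : Prop :=
  (∀ j k, ‖greenFunction A z j k‖ ≤ b) ∧ ∀ i j k, ‖minorGreen A z i j k‖ ≤ b

variable {A : Matrix n n ℝ} (hA : A.IsSymm) {z : ℂ} (hz : 0 < z.im)
include hA

theorem minorGreen_symm (i j k : n) : minorGreen A z i j k = minorGreen A z i k j := by
  simp only [minorGreen, or_comm, greenFunction_symm (isolate_isSymm hA i) j k]

include hz

theorem sum_norm_sq_minorGreen_le {b : ℝ} {i : n} (hb : ∀ j k, ‖minorGreen A z i j k‖ ≤ b)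
    (j : n) : ∑ k, ‖minorGreen A z i j k‖ ^ 2 ≤ b / z.im := by
  by_cases hj : j = i
  · have : 0 ≤ b := (norm_nonneg _).trans (hb i i)
    simp only [minorGreen, hj, true_or, if_true, norm_zero]
    simp
    positivity
  · have h1 := hb j j
    simp only [minorGreen, hj, or_self, if_false] at h1
    refine le_trans (Finset.sum_le_sum fun k _ => ?_)
      (sum_norm_sq_greenFunction_le (isolate_isSymm hA i) hz j h1)
    rw [minorGreen]
    split_ifs
    · simp
    · exact le_rfl

/-- Starts the bootstrap at imaginary part 1. -/
theorem greenBounded_one_div : GreenBounded A z (1 / z.im) := by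
  refine ⟨norm_greenFunction_le hA hz, fun i j k => ?_⟩
  rw [minorGreen]
  split_ifs
  · simp [hz.le]
  · exact norm_greenFunction_le (isolate_isSymm hA i) hz j k

theorem GreenBounded.half {w : ℂ} (hw : w.im = 2 * z.im) (hre : w.re = z.re) {b : ℝ}
    (h : GreenBounded A w b) : GreenBounded A z (2 * b) := by
  refine ⟨fun j k => norm_greenFunction_le_two_mul hA hz hw hre (h.1 _ _) (h.1 _ _) (h.1 _ _),
    fun i j k => ?_⟩
  have h1 := h.2 i
  rw [minorGreen]
  split_ifs with hjk
  · simp only [norm_zero]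
    have := (norm_nonneg _).trans (h1 i i)
    linarith
  · push Not at hjk
    refine norm_greenFunction_le_two_mul (isolate_isSymm hA i) hz hw hre ?_ ?_ ?_
    · simpa [minorGreen, hjk] using h1 j j
    · simpa [minorGreen, hjk] using h1 k k
    · simpa [minorGreen, hjk] using h1 j k

theorem minorRow_self (i : n) : minorRow A z i i = 0 := by
  refine Finset.sum_eq_zero fun l _ => ?_
  rw [greenFunction_symm (isolate_isSymm hA i), greenFunction_isolate_self hA hz]
  by_cases h : l = i <;> simp [h, offDiagRow]

/-- Replaces the trace of the minor's Green function by the full trace, up to a rank-one error and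
the missing i-th term. -/
theorem minorGreen_diag_sub (i j : n) :
    minorGreen A z i j j = greenFunction A z j j - greenFunction A z i i * minorRow A z i j ^ 2
      - if j = i then greenFunction A z i i else 0 := by
  by_cases hj : j = i
  · subst hj
    simp [minorGreen, minorRow_self hA hz]
  · simp only [minorGreen, hj, or_self, if_false]
    rw [greenFunction_minor hA hz i hj hj]
    ring

/-- The approximate self-consistent equation for the diagonal of the Green function. -/
theorem norm_one_add_greenFunction_mul_le {Γ ε ε₁ ε₂ κ : ℝ} (hκ0 : 0 ≤ κ)
    (hΓ : ∀ j k, ‖greenFunction A z j k‖ ≤ Γ) {i : n}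
    (hy : ∀ j, ‖minorRow A z i j‖ ≤ ε)
    (hq : ‖∑ j, (offDiagRow A i j : ℂ) * minorRow A z i j
      - (κ / Fintype.card n : ℝ) * ∑ j, minorGreen A z i j j‖ ≤ ε₁) (ha : |A i i| ≤ ε₂) :
    ‖1 + greenFunction A z i i * (z + κ * ((∑ j, greenFunction A z j j) / Fintype.card n))‖
      ≤ Γ * (ε₂ + ε₁ + κ * (Γ * ε ^ 2 + Γ / Fintype.card n)) := by
  set G := greenFunction A z with hG
  set T := ∑ j, (offDiagRow A i j : ℂ) * minorRow A z i j with hT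
  have hN : (0 : ℝ) < Fintype.card n := by
    exact_mod_cast Fintype.card_pos_iff.2 ⟨i⟩
  have hN' : (Fintype.card n : ℂ) ≠ 0 := by exact_mod_cast hN.ne'
  have hG0 : 0 ≤ Γ := (norm_nonneg _).trans (hΓ i i)
  have hsch : G i i * (A i i - z - T) = 1 := greenFunction_schur hA hz i
  have hsum : ∑ j, minorGreen A z i j j = ∑ j, G j j - G i i * ∑ j, minorRow A z i j ^ 2 - G i i := by
    rw [Finset.sum_congr rfl fun j _ => minorGreen_diag_sub hA hz i j]
    simp [Finset.sum_sub_distrib, Finset.mul_sum, hG]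
  have e1 : 1 + G i i * (z + κ * ((∑ j, G j j) / Fintype.card n))
      = G i i * (A i i - (T - (κ / Fintype.card n : ℝ) * ∑ j, minorGreen A z i j j)
        + κ * (G i i * ((∑ j, minorRow A z i j ^ 2) / Fintype.card n)
          + G i i / Fintype.card n)) := by
    rw [hsum]
    push_cast
    rw [← hsch]
    field_simp
    ring
  rw [e1, norm_mul]
  have h1 : ‖∑ j, minorRow A z i j ^ 2‖ ≤ Fintype.card n * ε ^ 2 := by
    rw [← Finset.card_univ, ← nsmul_eq_mul]
    refine (norm_sum_le _ _).trans (Finset.sum_le_card_nsmul _ _ _ fun j _ => ?_)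
    rw [norm_pow]
    gcongr
    exact hy j
  have h2 : ‖G i i * ((∑ j, minorRow A z i j ^ 2) / Fintype.card n)‖ ≤ Γ * ε ^ 2 := by
    rw [norm_mul, norm_div, Complex.norm_natCast]
    gcongr
    · exact hΓ i i
    · rw [div_le_iff₀ hN]; linarith
  have h3 : ‖G i i / Fintype.card n‖ ≤ Γ / Fintype.card n := by
    rw [norm_div, Complex.norm_natCast]
    gcongr
    exact hΓ i i
  gcongr
  · exact hΓ i i
  · refine (norm_add_le _ _).trans (add_le_add ((norm_sub_le _ _).trans (add_le_add ?_ hq)) ?_)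
    · simpa using ha
    · rw [norm_mul, Complex.norm_real, Real.norm_of_nonneg hκ0]
      gcongr
      exact (norm_add_le _ _).trans (add_le_add h2 h3)

omit hA hz [DecidableEq n] in
/-- Stability of the self-consistent equation: solutions bounded a priori satisfy a better bound. -/
theorem norm_le_of_self_consistent {g : n → ℂ} {κ b : ℝ} (hκ1 : 1 ≤ κ) (hκ2 : κ ≤ 2)
    (hz1 : z.im ≤ 1) (hz0 : 0 < z.im)
    (hb : |z.re| ≤ 10 ∧ b = 36 ∨ 10 < |z.re| ∧ b = 1 ∧ ∀ i, ‖g i‖ ≤ 4)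
    (h : ∀ i, ‖1 + g i * (z + κ * ((∑ j, g j) / Fintype.card n))‖ ≤ 1 / 2) (i : n) :
    ‖g i‖ ≤ b := by
  set a := (∑ j, g j) / (Fintype.card n : ℂ) with ha
  set w := z + κ * a with hw
  have hN : (0 : ℝ) < Fintype.card n := by
    exact_mod_cast Fintype.card_pos_iff.2 ⟨i⟩
  have hN' : (Fintype.card n : ℂ) ≠ 0 := by exact_mod_cast hN.ne'
  have hup : ‖g i‖ * ‖w‖ ≤ 3 / 2 := by
    have : ‖g i * w‖ ≤ ‖1 + g i * w‖ + ‖(1 : ℂ)‖ := by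
      have := norm_sub_le (1 + g i * w) 1
      simpa using this
    rw [norm_mul, norm_one] at this
    linarith [h i]
  have hnw : ‖κ * a‖ = κ * ‖a‖ := by
    rw [norm_mul, Complex.norm_real, Real.norm_of_nonneg (by linarith)]
  rcases hb with ⟨hre, rfl⟩ | ⟨hre, rfl, hg⟩
  -- If |w| < 1, then the mean a of g satisfies |a| ≤ 12 since |z| ≤ 11. The averaged equation gives
  -- |a||w| ≥ 1/2, hence |w| ≥ 1/24 and |g| ≤ (3/2)·24 = 36.
  · by_cases h1 : 1 ≤ ‖w‖
    · nlinarith [norm_nonneg (g i)]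
    push Not at h1
    have hz' : ‖z‖ ≤ 11 := by
      refine (Complex.norm_le_abs_re_add_abs_im z).trans ?_
      rw [abs_of_pos hz0]; linarith
    have ha12 : ‖a‖ ≤ 12 := by
      have : κ * ‖a‖ ≤ ‖w‖ + ‖z‖ := by
        rw [← hnw]
        have := norm_sub_le w z
        rwa [hw, add_sub_cancel_left] at this
      nlinarith [norm_nonneg a]
    have hlow : 1 / 2 ≤ ‖a‖ * ‖w‖ := by
      have e : 1 + a * w = (∑ j, (1 + g j * w)) / Fintype.card n := by
        rw [Finset.sum_add_distrib, ← Finset.sum_mul, ha]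
        simp only [Finset.sum_const, Finset.card_univ, nsmul_eq_mul, mul_one]
        field_simp
      have h2 : ‖1 + a * w‖ ≤ 1 / 2 := by
        rw [e, norm_div, Complex.norm_natCast, div_le_iff₀ hN]
        calc _ ≤ ∑ j, ‖1 + g j * w‖ := norm_sum_le _ _
          _ ≤ Fintype.card n • (1 / 2 : ℝ) := by
            rw [← Finset.card_univ]
            exact Finset.sum_le_card_nsmul _ _ _ fun j _ => h j
          _ = _ := by rw [nsmul_eq_mul]; ring
      have h3 : ‖(1 : ℂ)‖ ≤ ‖1 + a * w‖ + ‖a * w‖ := by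
        have := norm_sub_le (1 + a * w) (a * w)
        simpa using this
      rw [norm_one, norm_mul] at h3
      linarith
    have hw24 : 1 / 24 ≤ ‖w‖ := by nlinarith [norm_nonneg w]
    nlinarith [norm_nonneg (g i)]
  -- At high energy the equation also has a spurious solution with mean near -z/κ. The a priori
  -- bound 4 excludes it: |w| ≥ 10 - 2·4 = 2, so |g| ≤ 3/4.
  · have ha4 : ‖a‖ ≤ 4 := by
      rw [ha, norm_div, Complex.norm_natCast, div_le_iff₀ hN, mul_comm, ← nsmul_eq_mul,
        ← Finset.card_univ]
      exact (norm_sum_le _ _).trans (Finset.sum_le_card_nsmul _ _ _ fun j _ => hg j)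
    have hz' : 10 ≤ ‖z‖ := hre.le.trans (Complex.abs_re_le_norm z)
    have h2 : ‖z‖ ≤ ‖w‖ + κ * ‖a‖ := by
      rw [← hnw]
      have := norm_sub_le w (κ * a)
      rwa [hw, add_sub_cancel_right] at this
    have hw2 : 2 ≤ ‖w‖ := by nlinarith [norm_nonneg a]
    nlinarith [norm_nonneg (g i)]

/-- One step of the bootstrap: a priori bounds on the Green functions together with small errors in
Schur's formula yield an improved bound. -/
theorem GreenBounded.improve {Γ ε ε₁ ε₂ κ b : ℝ} (hκ1 : 1 ≤ κ) (hκ2 : κ ≤ 2) (hz1 : z.im ≤ 1)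
    (hb : |z.re| ≤ 10 ∧ b = 36 ∨ 10 < |z.re| ∧ b = 1 ∧ Γ ≤ 4) (h : GreenBounded A z Γ)
    (hΓ : Γ ≤ 74) (hε : 74 * ε ≤ 1)
    (hε' : 74 * (ε₂ + ε₁ + 2 * (74 * ε ^ 2 + 74 / Fintype.card n)) ≤ 1 / 2)
    (hy : ∀ i j, ‖minorRow A z i j‖ ≤ ε)
    (hq : ∀ i, ‖∑ j, (offDiagRow A i j : ℂ) * minorRow A z i j
      - (κ / Fintype.card n : ℝ) * ∑ j, minorGreen A z i j j‖ ≤ ε₁)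
    (ha : ∀ i, |A i i| ≤ ε₂) : GreenBounded A z (b + 1) := by
  have hb1 : 1 ≤ b := by rcases hb with ⟨_, rfl⟩ | ⟨_, rfl, _⟩ <;> norm_num
  have hdiag : ∀ i, ‖greenFunction A z i i‖ ≤ b := by
    refine norm_le_of_self_consistent (κ := κ) hκ1 hκ2 hz1 hz ?_ fun i => ?_
    · rcases hb with hb | ⟨h1, h2, h3⟩
      · exact Or.inl hb
      · exact Or.inr ⟨h1, h2, fun i => (h.1 i i).trans h3⟩
    · refine (norm_one_add_greenFunction_mul_le hA hz (by linarith) h.1 (hy i) (hq i)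
        (ha i)).trans (le_trans ?_ hε')
      have hε0 : 0 ≤ ε := (norm_nonneg _).trans (hy i i)
      have hε1 : 0 ≤ ε₁ := (norm_nonneg _).trans (hq i)
      have hε2 : 0 ≤ ε₂ := (abs_nonneg _).trans (ha i)
      have hΓ0 : 0 ≤ Γ := (norm_nonneg _).trans (h.1 i i)
      gcongr
  -- This product is minus an off-diagonal entry of the Green function, and also controls the
  -- difference between the full and minor Green functions.
  have hGε : ∀ i j, ‖greenFunction A z i i * minorRow A z i j‖ ≤ 1 := fun i j => by
    rw [norm_mul]
    calc _ ≤ 74 * ε := mul_le_mul ((h.1 i i).trans hΓ) (hy i j) (norm_nonneg _) (by norm_num)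
      _ ≤ 1 := hε
  have hall : ∀ j k, ‖greenFunction A z j k‖ ≤ b := by
    intro j k
    by_cases hjk : j = k
    · subst hjk; exact hdiag j
    · rw [greenFunction_off_diag hA hz k hjk, neg_mul, norm_neg]
      exact (hGε k j).trans hb1
  refine ⟨fun j k => (hall j k).trans (by linarith), fun i j k => ?_⟩
  rw [minorGreen]
  split_ifs with hjk
  · simp; linarith
  · push Not at hjk
    rw [greenFunction_minor hA hz i hjk.1 hjk.2]
    refine (norm_sub_le _ _).trans (add_le_add (hall j k) ?_)
    rw [norm_mul]
    have : ‖minorRow A z i j‖ ≤ 1 := (hy i j).trans (by linarith)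
    exact mul_le_one₀ (hGε i k) (norm_nonneg _) this

end MinorGreen

/-! ### Typical rows of the random graph and the dyadic bootstrap. -/

section SparseGraph

variable {V : Type*} [Fintype V] [DecidableEq V]

/-- The adjacency matrix of the graph with edge indicators `X`. -/
noncomputable def adjacency (X : Sym2 V → Bool) : Matrix V V ℝ :=
  fun i j => if X s(i, j) then 1 else 0

omit [Fintype V] [DecidableEq V] in
theorem smul_adjacency_isSymm (c : ℝ) (X : Sym2 V → Bool) : (c • adjacency X).IsSymm := by
  ext i j
  simp [adjacency, Sym2.eq_swap]

theorem minorRow_adjacency (c : ℝ) (X : Sym2 V → Bool) {z : ℂ} (hz : 0 < z.im) (i j : V) :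
    minorRow (c • adjacency X) z i j
      = c * ∑ k ∈ selected (fun j => X s(i, j)), minorGreen (c • adjacency X) z i j k := by
  have hA := smul_adjacency_isSymm c X
  rw [selected, Finset.sum_filter, Finset.mul_sum]
  refine Finset.sum_congr rfl fun l _ => ?_
  by_cases hl : l = i
  · simp [hl, offDiagRow, minorGreen]
  · by_cases hj : j = i
    · subst hj
      rw [greenFunction_symm (isolate_isSymm hA _), greenFunction_isolate_self hA hz]
      simp [minorGreen, hl]
    · simp only [hl, hj, offDiagRow, minorGreen, adjacency, Matrix.smul_apply, smul_eq_mul,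
        or_self, if_false]
      split_ifs <;> simp [mul_comm]

theorem sum_offDiagRow_mul_minorRow (c : ℝ) (X : Sym2 V → Bool) {z : ℂ} (hz : 0 < z.im) (i : V) :
    ∑ j, (offDiagRow (c • adjacency X) i j : ℂ) * minorRow (c • adjacency X) z i j
      = c ^ 2 * (∑ j ∈ selected (fun j => X s(i, j)), minorGreen (c • adjacency X) z i j j
        + ∑ a ∈ (selected (fun j => X s(i, j))).offDiag,
          minorGreen (c • adjacency X) z i a.1 a.2) := by
  have hA := smul_adjacency_isSymm c X
  set S := selected (fun j => X s(i, j)) with hS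
  have h1 : ∑ j ∈ S, minorGreen (c • adjacency X) z i j j
        + ∑ a ∈ S.offDiag, minorGreen (c • adjacency X) z i a.1 a.2
      = ∑ j ∈ S, ∑ k ∈ S, minorGreen (c • adjacency X) z i j k := by
    rw [← Finset.sum_product', ← Finset.diag_union_offDiag,
      Finset.sum_union (Finset.disjoint_diag_offDiag S), Finset.sum_diag]
  rw [h1, hS, selected, Finset.sum_filter, Finset.mul_sum]
  refine Finset.sum_congr rfl fun j _ => ?_
  rw [minorRow_adjacency c X hz]
  by_cases hj : j = i
  · subst hj
    simp [offDiagRow, minorGreen]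
  · by_cases hX : X s(i, j) = true
    · simp [offDiagRow, hj, hX, adjacency, selected]
      ring
    · simp [offDiagRow, hj, hX, adjacency]

/-- The `i`-th row of the graph is atypical with respect to the Green function of the `i`-th minor,
although the latter is bounded by `Γ`. -/
def atypicalRow (c p a₁ a₂ a₃ Γ : ℝ) (z : ℂ) (i : V) : Set (Sym2 V → Bool) :=
  {X | (∀ j k, ‖minorGreen (c • adjacency X) z i j k‖ ≤ Γ) ∧
    ¬ IsTypicalRow (minorGreen (c • adjacency X) z i) p a₁ a₂ a₃ fun j => X s(i, j)}

/-- Needed because resampling leaves the loop at i untouched, while the fresh row has an independent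
i-th entry. -/
theorem IsTypicalRow.congr_of_eq_zero {R : V → V → ℂ} {p a₁ a₂ a₃ : ℝ} {x y : V → Bool} (i : V)
    (hR : ∀ j k, j = i ∨ k = i → R j k = 0) (hxy : ∀ j, j ≠ i → x j = y j)
    (h : IsTypicalRow R p a₁ a₂ a₃ x) : IsTypicalRow R p a₁ a₂ a₃ y := by
  have h2 : ∀ x : V → Bool, ∑ a ∈ (selected x).offDiag, R a.1 a.2
      = ∑ a : V × V, if a.1 ≠ a.2 then
        (if x a.1 then (if x a.2 then R a.1 a.2 else 0) else 0) else 0 := by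
    intro x
    rw [← Finset.sum_filter, ← Finset.sum_filter, ← Finset.sum_filter]
    refine Finset.sum_congr ?_ fun _ _ => rfl
    ext a
    simp [selected]
    tauto
  have h3 : ∀ (x : V → Bool) j, ∑ k ∈ selected x, R j k = ∑ k, if x k then R j k else 0 := by
    intro x j
    rw [selected, Finset.sum_filter]
  refine ⟨?_, ?_, fun j => ?_⟩
  · refine le_trans (le_of_eq ?_) h.diag
    congr 1
    refine Finset.sum_congr rfl fun j _ => ?_
    by_cases hj : j = i
    · simp [hR j j (Or.inl hj)]
    · rw [hxy j hj]
  · refine le_trans (le_of_eq ?_) h.offDiag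
    rw [h2, h2]
    congr 1
    refine Finset.sum_congr rfl fun a _ => ?_
    by_cases h1 : a.1 = i
    · simp [hR a.1 a.2 (Or.inl h1)]
    · by_cases h2 : a.2 = i
      · simp [hR a.1 a.2 (Or.inr h2)]
      · rw [hxy _ h1, hxy _ h2]
  · refine le_trans (le_of_eq ?_) (h.linear j)
    rw [h3, h3]
    congr 1
    refine Finset.sum_congr rfl fun k _ => ?_
    by_cases h1 : k = i
    · simp [hR j k (Or.inr h1)]
    · rw [hxy _ h1]

/-- The minor's Green function does not see row i, so after resampling it is a fixed coefficient
matrix. The bound Γ is part of the event: it fails or holds for all resamplings together, and when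
it holds the Ward identity supplies W = Γ / Im z. -/
theorem bernoulliProb_atypicalRow_le {q : Sym2 V → ℝ} (h0 : ∀ e, 0 ≤ q e) (h1 : ∀ e, q e ≤ 1)
    {p : ℝ} (hq : ∀ i j, j ≠ i → q s(i, j) = p) (hp0 : 0 ≤ p) (hp1 : p ≤ 1) (c : ℝ) {z : ℂ}
    (hz : 0 < z.im) {Γ δ t : ℝ} (hΓ : 1 ≤ Γ) (hδ : 0 < δ) (ht : 0 ≤ t) (htΓ : t * Γ ≤ 1) (τ : ℝ)
    (l m : ℕ) (i : V) :
    bernoulliProb q (atypicalRow c p (2 * τ)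
        (4 * l * m * Γ + δ * (p * Fintype.card V + τ) ^ 2)
        (l * Γ + δ * (p * Fintype.card V + τ)) Γ z i)
      ≤ 6 * Real.exp (t ^ 2 * (p * Fintype.card V) * Γ ^ 2 - t * τ)
        + Fintype.card V * (Γ / z.im / δ ^ 2 * p) ^ l
        + (Fintype.card V * (Γ / z.im / δ ^ 2) * p ^ 2) ^ m := by
  refine bernoulliProb_le_of_resampleRow h0 h1 i (hq i) _ fun X => ?_
  have hiso : ∀ ζ, minorGreen (c • adjacency (resampleRow X i ζ)) z i
      = minorGreen (c • adjacency X) z i := by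
    intro ζ
    have : isolate (c • adjacency (resampleRow X i ζ)) i = isolate (c • adjacency X) i := by
      ext j k
      simp only [isolate]
      split_ifs with hjk
      · rfl
      · push Not at hjk
        simp only [Matrix.smul_apply, adjacency]
        rw [resampleRow_of_not]
        simp [hjk.1.symm, hjk.2.symm]
    funext j k
    rw [minorGreen, minorGreen, this]
  have hA := smul_adjacency_isSymm c X
  have hz0 := hz.le
  by_cases hb : ∀ j k, ‖minorGreen (c • adjacency X) z i j k‖ ≤ Γ
  · refine le_trans (bernoulliProb_mono (fun _ => hp0) (fun _ => hp1) ?_)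
      (bernoulliProb_not_isTypicalRow_le hp0 hp1 (R := minorGreen (c • adjacency X) z i)
        (minorGreen_symm hA i) hΓ hb (sum_norm_sq_minorGreen_le hA hz hb) hδ ht htΓ τ l m)
    intro ζ hζ hn
    have hζ : resampleRow X i ζ ∈ atypicalRow c p _ _ _ Γ z i := hζ
    refine hζ.2 ?_
    rw [hiso]
    refine hn.congr_of_eq_zero i (fun j k h => by simp [minorGreen, h]) fun j hj => ?_
    exact (resampleRow_row X ζ hj).symm
  · refine le_trans (bernoulliProb_mono (fun _ => hp0) (fun _ => hp1) (T := ∅) ?_) ?_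
    · intro ζ hζ
      have hζ : resampleRow X i ζ ∈ atypicalRow c p _ _ _ Γ z i := hζ
      have := hζ.1
      rw [hiso] at this
      exact hb this
    · simp only [bernoulliProb, bernoulliExp, Set.indicator_empty, mul_zero, Finset.sum_const_zero]
      positivity

/-- If no row is atypical at the dyadic scales `1, 1/2, …, 2⁻ˢ`, then the Green function is bounded
down to the scale `2⁻ˢ`. -/
theorem greenBounded_of_notMem_atypicalRow {c p a₁ a₂ a₃ : ℝ} (hp0 : 0 < p) (hp1 : p ≤ 1 / 2)
    (hc0 : 0 ≤ c) (hc : c ^ 2 * (p * (1 - p) * Fintype.card V) = 1) (hε : 74 * (c * a₃) ≤ 1)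
    (hε' : 74 * (c + c ^ 2 * (a₁ + a₂) + 2 * (74 * (c * a₃) ^ 2 + 74 / Fintype.card V)) ≤ 1 / 2)
    (X : Sym2 V → Bool) (E : ℝ) (s : ℕ)
    (hX : ∀ r ≤ s, ∀ i, X ∉ atypicalRow c p a₁ a₂ a₃ 74 ⟨E, (1 / 2) ^ r⟩ i) :
    GreenBounded (c • adjacency X) ⟨E, (1 / 2) ^ s⟩ 37 := by
  have hA := smul_adjacency_isSymm c X
  -- The inductive bound is b + 1. After halving the scale it becomes 2(b + 1), which is 74 at low
  -- energy and 4 at high energy: exactly the a priori bounds that the improvement step accepts.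
  suffices H : ∀ b : ℝ, (|E| ≤ 10 ∧ b = 36 ∨ 10 < |E| ∧ b = 1) → ∀ s : ℕ,
      (∀ r ≤ s, ∀ i, X ∉ atypicalRow c p a₁ a₂ a₃ 74 ⟨E, (1 / 2) ^ r⟩ i) →
      GreenBounded (c • adjacency X) ⟨E, (1 / 2) ^ s⟩ (b + 1) by
    rcases le_or_gt |E| 10 with h | h
    · have := H 36 (Or.inl ⟨h, rfl⟩) s hX
      norm_num at this ⊢
      exact this
    · obtain ⟨h1, h2⟩ := H 1 (Or.inr ⟨h, rfl⟩) s hX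
      exact ⟨fun j k => (h1 j k).trans (by norm_num), fun i j k => (h2 i j k).trans (by norm_num)⟩
  intro b hb s
  have hb36 : 1 ≤ b ∧ b ≤ 36 := by rcases hb with ⟨_, rfl⟩ | ⟨_, rfl⟩ <;> norm_num
  induction s with
  | zero =>
    intro _
    have h := greenBounded_one_div hA (z := ⟨E, (1 / 2) ^ 0⟩) (by simp)
    simp only [pow_zero, div_one] at h ⊢
    exact ⟨fun j k => (h.1 j k).trans (by linarith), fun i j k => (h.2 i j k).trans (by linarith)⟩
  | succ s ih =>
    intro hX
    have hz : 0 < (⟨E, (1 / 2) ^ (s + 1)⟩ : ℂ).im := by simp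
    have hpre : GreenBounded (c • adjacency X) ⟨E, (1 / 2) ^ (s + 1)⟩ (2 * (b + 1)) := by
      refine GreenBounded.half hA hz (w := ⟨E, (1 / 2) ^ s⟩) ?_ rfl
        (ih fun r hr i => hX r (hr.trans (Nat.le_succ s)) i)
      simp only [pow_succ]; ring
    have htyp : ∀ i, IsTypicalRow (minorGreen (c • adjacency X) ⟨E, (1 / 2) ^ (s + 1)⟩ i) p
        a₁ a₂ a₃ fun j => X s(i, j) := by
      intro i
      by_contra hn
      exact hX (s + 1) le_rfl i ⟨fun j k => (hpre.2 i j k).trans (by linarith), hn⟩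
    have hκ : (0 : ℝ) < 1 - p := by linarith
    refine hpre.improve (κ := 1 / (1 - p)) (ε := c * a₃) (ε₁ := c ^ 2 * (a₁ + a₂)) (ε₂ := c) hA hz
      ?_ ?_ ?_ ?_ (by linarith) hε hε' (fun i j => ?_) (fun i => ?_) (fun i => ?_)
    · rw [le_div_iff₀ hκ]; linarith
    · rw [div_le_iff₀ hκ]; linarith
    · exact pow_le_one₀ (by norm_num) (by norm_num)
    · rcases hb with ⟨h1, rfl⟩ | ⟨h1, rfl⟩
      · exact Or.inl ⟨h1, rfl⟩
      · exact Or.inr ⟨h1, rfl, by norm_num⟩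
    · rw [minorRow_adjacency c X hz, norm_mul, Complex.norm_real, Real.norm_of_nonneg hc0]
      exact mul_le_mul_of_nonneg_left ((htyp i).linear j) hc0
    · have hN : (0 : ℝ) < Fintype.card V := by
        exact_mod_cast Fintype.card_pos_iff.2 ⟨i⟩
      -- The entries are normalised by p(1 - p) but have second moment proportional to p, whence κ =
      -- 1/(1 - p).
      have hκc : 1 / (1 - p) / (Fintype.card V : ℝ) = c ^ 2 * p := by
        field_simp
        linear_combination - hc
      rw [hκc, sum_offDiagRow_mul_minorRow c X hz]
      set R := minorGreen (c • adjacency X) ⟨E, (1 / 2) ^ (s + 1)⟩ i with hR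
      have e1 : ∑ j ∈ selected (fun j => X s(i, j)), R j j - p * ∑ j, R j j
          = ∑ j, ((if X s(i, j) then 1 else 0 : ℂ) - p) * R j j := by
        rw [selected, Finset.sum_filter, Finset.mul_sum, ← Finset.sum_sub_distrib]
        refine Finset.sum_congr rfl fun j _ => ?_
        split_ifs <;> ring
      have e2 : (c : ℂ) ^ 2 * (∑ j ∈ selected (fun j => X s(i, j)), R j j
          + ∑ a ∈ (selected (fun j => X s(i, j))).offDiag, R a.1 a.2)
          - ((c ^ 2 * p : ℝ) : ℂ) * ∑ j, R j j
          = (c : ℂ) ^ 2 * (∑ j, ((if X s(i, j) then 1 else 0 : ℂ) - p) * R j j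
          + ∑ a ∈ (selected (fun j => X s(i, j))).offDiag, R a.1 a.2) := by
        rw [← e1]; push_cast; ring
      rw [e2, norm_mul, norm_pow, Complex.norm_real, Real.norm_of_nonneg hc0]
      exact mul_le_mul_of_nonneg_left ((norm_add_le _ _).trans
        (add_le_add (htyp i).diag (htyp i).offDiag)) (by positivity)
    · simp only [Matrix.smul_apply, adjacency, smul_eq_mul, abs_mul, abs_of_nonneg hc0]
      split_ifs <;> simp [hc0]

end SparseGraph

/-! ### Moments of sums matched by a random permutation. -/

section Permutation

variable {V : Type*} [Fintype V]

/-- The sum of products of two families matched by a permutation. -/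
def permSum (a x : V → ℝ) (π : Equiv.Perm V) : ℝ := ∑ i, a (π i) * x i

theorem sub_mul_pow_sub_pow_le (x y : ℝ) (n : ℕ) :
    (x - y) * (x ^ (2 * n + 1) - y ^ (2 * n + 1))
      ≤ (2 * n + 1) * ((x - y) ^ 2 * (x ^ (2 * n) + y ^ (2 * n))) := by
  have h := (Commute.all x y).mul_geom_sum₂ (2 * n + 1)
  have h1 : ∑ k ∈ Finset.range (2 * n + 1), x ^ k * y ^ (2 * n + 1 - 1 - k)
      ≤ (2 * n + 1) * (x ^ (2 * n) + y ^ (2 * n)) := by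
    refine (Finset.sum_le_card_nsmul _ _ (x ^ (2 * n) + y ^ (2 * n)) fun k hk => ?_).trans
      (le_of_eq ?_)
    · have hk : k ≤ 2 * n := Nat.lt_succ_iff.1 (Finset.mem_range.1 hk)
      have e : ∀ u : ℝ, u ^ (2 * n) = |u| ^ (2 * n) := fun u => by
        rw [pow_mul, pow_mul, sq_abs]
      refine (le_abs_self _).trans ?_
      rw [abs_mul, abs_pow, abs_pow, Nat.add_sub_cancel, e x, e y]
      have hx := abs_nonneg x
      have hy := abs_nonneg y
      rcases le_total |x| |y| with hxy | hxy
      · calc _ ≤ |y| ^ k * |y| ^ (2 * n - k) := by gcongr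
          _ = |y| ^ (2 * n) := by rw [← pow_add, Nat.add_sub_cancel' hk]
          _ ≤ _ := le_add_of_nonneg_left (by positivity)
      · calc _ ≤ |x| ^ k * |x| ^ (2 * n - k) := by gcongr
          _ = |x| ^ (2 * n) := by rw [← pow_add, Nat.add_sub_cancel' hk]
          _ ≤ _ := le_add_of_nonneg_right (by positivity)
    · rw [Finset.card_range, nsmul_eq_mul]; push_cast; ring
  rw [← h, ← mul_assoc, ← pow_two]
  calc _ ≤ (x - y) ^ 2 * ((2 * n + 1) * (x ^ (2 * n) + y ^ (2 * n))) := by gcongr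
    _ = _ := by ring

variable [DecidableEq V]

theorem permSum_mul_swap (a x : V → ℝ) (π : Equiv.Perm V) (i j : V) :
    permSum a x π - permSum a x (π * Equiv.swap i j) = (a (π i) - a (π j)) * (x i - x j) := by
  by_cases hij : i = j
  · subst hij
    have : π * Equiv.swap i i = π := by ext; simp
    rw [this]; simp
  rw [permSum, permSum, ← Finset.sum_sub_distrib]
  have h : ∀ k ∈ Finset.univ, k ≠ i ∧ k ≠ j →
      a (π k) * x k - a ((π * Equiv.swap i j) k) * x k = 0 := by
    intro k _ hk
    rw [Equiv.Perm.mul_apply, Equiv.swap_apply_of_ne_of_ne hk.1 hk.2, sub_self]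
  rw [Finset.sum_eq_add i j hij h (by simp) (by simp)]
  simp
  ring

/-- Exchangeable pairs. Let Y be the sum at π and Y' the sum after a transposition. Since the
weights sum to zero, Y - Y' summed over all transpositions is 2NY. Multiplying by a power of Y and
symmetrising in (Y, Y') turns the next even moment into a sum of (Y - Y')² Y^(2n), and the squared
increments have a deterministic total. -/
theorem sum_permSum_pow_succ_le [Nonempty V] {a x : V → ℝ} {B : ℝ} (ha : ∑ i, a i = 0)
    (hx : ∀ i, |x i| ≤ B) (n : ℕ) :
    ∑ π, permSum a x π ^ (2 * (n + 1))
      ≤ (2 * n + 1) * (4 * (B ^ 2 * ∑ i, a i ^ 2)) * ∑ π, permSum a x π ^ (2 * n) := by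
  set N : ℝ := (Fintype.card V : ℝ) with hN
  have hN0 : 0 < N := by simp [hN, Fintype.card_pos]
  have hperm : ∀ (π : Equiv.Perm V) (f : V → ℝ), ∑ i, f (π i) = ∑ i, f i :=
    fun π f => Equiv.sum_comp π f
  have h1 : ∀ π, ∑ i, ∑ j, (permSum a x π - permSum a x (π * Equiv.swap i j))
      = 2 * N * permSum a x π := by
    intro π
    have hin : ∀ i, ∑ j, (permSum a x π - permSum a x (π * Equiv.swap i j))
        = N * (a (π i) * x i) - a (π i) * ∑ j, x j + permSum a x π := by
      intro i
      rw [Finset.sum_congr rfl fun j _ => permSum_mul_swap a x π i j, permSum]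
      simp only [sub_mul, mul_sub, Finset.sum_sub_distrib, ← Finset.mul_sum,
        ← Finset.sum_mul, hperm π a, ha, Finset.sum_const, Finset.card_univ, nsmul_eq_mul, ← hN]
      ring
    simp only [hin, Finset.sum_add_distrib, Finset.sum_sub_distrib, ← Finset.mul_sum,
      ← Finset.sum_mul, hperm π a, ha, Finset.sum_const, Finset.card_univ, nsmul_eq_mul, ← hN]
    rw [← permSum]
    ring
  -- Right multiplication by a transposition is an involution on permutations, so π and its partner
  -- may be interchanged in the sums.
  have h2 : ∀ i j : V, ∑ π, (permSum a x π - permSum a x (π * Equiv.swap i j))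
        * permSum a x π ^ (2 * n + 1)
      ≤ (2 * n + 1) * ∑ π, (permSum a x π - permSum a x (π * Equiv.swap i j)) ^ 2
        * permSum a x π ^ (2 * n) := by
    intro i j
    have hinv : ∀ f : Equiv.Perm V → Equiv.Perm V → ℝ,
        ∑ π, f π (π * Equiv.swap i j) = ∑ π, f (π * Equiv.swap i j) π := by
      intro f
      refine Fintype.sum_equiv (Equiv.mulRight (Equiv.swap i j)) _ _ fun π => ?_
      simp [mul_assoc]
    have e1 := hinv fun π σ => (permSum a x π - permSum a x σ) * permSum a x π ^ (2 * n + 1)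
    have e2 := hinv fun π σ => (permSum a x π - permSum a x σ) ^ 2 * permSum a x π ^ (2 * n)
    have e3 := Finset.sum_le_sum (s := Finset.univ) fun (π : Equiv.Perm V) _ =>
      sub_mul_pow_sub_pow_le (permSum a x π) (permSum a x (π * Equiv.swap i j)) n
    simp only [mul_sub, mul_add, Finset.sum_sub_distrib, Finset.sum_add_distrib,
      ← Finset.mul_sum] at e3
    have e4 : ∑ π, (permSum a x (π * Equiv.swap i j) - permSum a x π)
        * permSum a x (π * Equiv.swap i j) ^ (2 * n + 1)
        = - ∑ π, (permSum a x π - permSum a x (π * Equiv.swap i j))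
        * permSum a x (π * Equiv.swap i j) ^ (2 * n + 1) := by
      rw [← Finset.sum_neg_distrib]
      exact Finset.sum_congr rfl fun π _ => by ring
    have e5 : ∑ π, (permSum a x (π * Equiv.swap i j) - permSum a x π) ^ 2
        * permSum a x (π * Equiv.swap i j) ^ (2 * n)
        = ∑ π, (permSum a x π - permSum a x (π * Equiv.swap i j)) ^ 2
        * permSum a x (π * Equiv.swap i j) ^ (2 * n) :=
      Finset.sum_congr rfl fun π _ => by ring
    rw [e4] at e1
    rw [e5] at e2
    rw [← e2] at e3
    linarith
  have h3 : ∀ π, ∑ i, ∑ j, (permSum a x π - permSum a x (π * Equiv.swap i j)) ^ 2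
      ≤ 2 * N * (4 * (B ^ 2 * ∑ i, a i ^ 2)) := by
    intro π
    have hle : ∀ i j, (permSum a x π - permSum a x (π * Equiv.swap i j)) ^ 2
        ≤ (4 * B ^ 2) * (a (π i) - a (π j)) ^ 2 := by
      intro i j
      rw [permSum_mul_swap, mul_pow, mul_comm]
      gcongr
      have h1 := abs_le.1 (hx i)
      have h2 := abs_le.1 (hx j)
      nlinarith
    calc _ ≤ ∑ i, ∑ j, (4 * B ^ 2) * (a (π i) - a (π j)) ^ 2 :=
          Finset.sum_le_sum fun i _ => Finset.sum_le_sum fun j _ => hle i j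
      _ = (4 * B ^ 2) * (2 * N * ∑ i, a i ^ 2) := by
          have hc : ∀ i, ∑ j, a (π i) * a (π j) = 0 := fun i => by
            rw [← Finset.mul_sum, hperm π a, ha, mul_zero]
          simp only [sub_sq, ← Finset.mul_sum, Finset.sum_add_distrib, Finset.sum_sub_distrib,
            mul_assoc, hc, hperm π fun i => a i ^ 2, Finset.sum_const, Finset.card_univ,
            nsmul_eq_mul, mul_zero]
          ring
      _ = _ := by ring
  have h4 : 2 * N * ∑ π, permSum a x π ^ (2 * (n + 1))
      = ∑ i, ∑ j, ∑ π, (permSum a x π - permSum a x (π * Equiv.swap i j))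
        * permSum a x π ^ (2 * n + 1) := by
    rw [Finset.mul_sum]
    calc _ = ∑ π, ∑ i, ∑ j, (permSum a x π - permSum a x (π * Equiv.swap i j))
        * permSum a x π ^ (2 * n + 1) := by
          refine Finset.sum_congr rfl fun π _ => ?_
          simp only [← Finset.sum_mul, h1]
          ring
      _ = _ := by
          rw [Finset.sum_comm]
          exact Finset.sum_congr rfl fun i _ => Finset.sum_comm
  have h5 : ∑ i, ∑ j, ∑ π, (permSum a x π - permSum a x (π * Equiv.swap i j)) ^ 2
        * permSum a x π ^ (2 * n)
      = ∑ π, (∑ i, ∑ j, (permSum a x π - permSum a x (π * Equiv.swap i j)) ^ 2)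
        * permSum a x π ^ (2 * n) := by
    simp only [Finset.sum_mul]
    symm
    rw [Finset.sum_comm]
    exact Finset.sum_congr rfl fun i _ => Finset.sum_comm
  have h6 : 2 * N * ∑ π, permSum a x π ^ (2 * (n + 1))
      ≤ (2 * n + 1) * (2 * N * (4 * (B ^ 2 * ∑ i, a i ^ 2)) * ∑ π, permSum a x π ^ (2 * n)) := by
    rw [h4]
    calc _ ≤ ∑ i, ∑ j, (2 * n + 1) * ∑ π, (permSum a x π - permSum a x (π * Equiv.swap i j)) ^ 2
        * permSum a x π ^ (2 * n) :=
          Finset.sum_le_sum fun i _ => Finset.sum_le_sum fun j _ => h2 i j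
      _ = (2 * n + 1) * ∑ π, (∑ i, ∑ j, (permSum a x π - permSum a x (π * Equiv.swap i j)) ^ 2)
        * permSum a x π ^ (2 * n) := by
          rw [← h5]; simp only [Finset.mul_sum]
      _ ≤ _ := by
          rw [Finset.mul_sum (a := 2 * N * _)]
          gcongr with π
          · exact (even_two_mul n).pow_nonneg _
          · exact h3 π
  refine le_of_mul_le_mul_left (h6.trans (le_of_eq ?_)) (by positivity : 0 < 2 * N)
  ring

theorem sum_permSum_pow_le [Nonempty V] {a x : V → ℝ} {B : ℝ} (ha : ∑ i, a i = 0)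
    (hx : ∀ i, |x i| ≤ B) {m n : ℕ} (hn : n ≤ m) :
    ∑ π, permSum a x π ^ (2 * n)
      ≤ Fintype.card (Equiv.Perm V) * (8 * m * (B ^ 2 * ∑ i, a i ^ 2)) ^ n := by
  induction n with
  | zero => simp
  | succ n ih =>
    have hV : 0 ≤ B ^ 2 * ∑ i, a i ^ 2 := by positivity
    have hm : ((n : ℝ) + 1) ≤ m := by exact_mod_cast hn
    refine (sum_permSum_pow_succ_le ha hx n).trans ?_
    calc _ ≤ (2 * n + 1) * (4 * (B ^ 2 * ∑ i, a i ^ 2)) *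
          (Fintype.card (Equiv.Perm V) * (8 * m * (B ^ 2 * ∑ i, a i ^ 2)) ^ n) := by
          gcongr
          exact ih (Nat.le_of_succ_le hn)
      _ ≤ (8 * m * (B ^ 2 * ∑ i, a i ^ 2)) *
          (Fintype.card (Equiv.Perm V) * (8 * m * (B ^ 2 * ∑ i, a i ^ 2)) ^ n) := by
          refine mul_le_mul_of_nonneg_right ?_ (by positivity)
          nlinarith [mul_nonneg (sub_nonneg.2 hm) hV]
      _ = _ := by ring

/-- Tail bound for sums matched by a uniformly random permutation. -/
theorem card_permSum_gt_le [Nonempty V] {a x : V → ℝ} {B : ℝ} (ha : ∑ i, a i = 0)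
    (hx : ∀ i, |x i| ≤ B) {T : ℝ} (hT : 0 < T) (m : ℕ) [∀ π, Decidable (T < |permSum a x π|)] :
    ((Finset.univ.filter fun π => T < |permSum a x π|).card : ℝ)
      ≤ Fintype.card (Equiv.Perm V) * (8 * m * (B ^ 2 * ∑ i, a i ^ 2) / T ^ 2) ^ m := by
  rw [div_pow, ← mul_div_assoc, le_div_iff₀ (by positivity), ← nsmul_eq_mul]
  refine le_trans ?_ (sum_permSum_pow_le ha hx (le_refl m))
  refine (Finset.card_nsmul_le_sum _ (fun π => permSum a x π ^ (2 * m)) _ fun π hπ => ?_).trans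
    (Finset.sum_le_sum_of_subset_of_nonneg (Finset.filter_subset _ _)
      fun _ _ _ => (even_two_mul m).pow_nonneg _)
  rw [pow_mul, ← sq_abs (permSum a x π)]
  have : T < |permSum a x π| := (Finset.mem_filter.1 hπ).2
  gcongr

end Permutation

/-! ### Quadratic forms of eigenvectors under relabelled weights. -/

section Eigenvector

variable {V : Type*} [Fintype V]

/-- `u` is a unit eigenvector of `A` with eigenvalue `lam`. -/
def IsUnitEigenvector (A : Matrix V V ℝ) (lam : ℝ) (u : V → ℝ) : Prop :=
  A.mulVec u = lam • u ∧ ∑ i, u i ^ 2 = 1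

/-- All unit eigenvectors of `A` have squared entries bounded by `B`. -/
def Delocalized (A : Matrix V V ℝ) (B : ℝ) : Prop :=
  ∀ lam u, IsUnitEigenvector A lam u → ∀ i, u i ^ 2 ≤ B

/-- Some unit eigenvector of `A` has a large quadratic form with the weights `a`. -/
def HasLargeObservable (A : Matrix V V ℝ) (a : V → ℝ) (T : ℝ) : Prop :=
  ∃ lam u, IsUnitEigenvector A lam u ∧ T < |∑ i, a i * u i ^ 2|

variable [DecidableEq V]

theorem exists_orthonormal_eigenvectors {A : Matrix V V ℝ} (hA : A.IsSymm) :
    ∃ (v : V → V → ℝ) (ev : V → ℝ), (∀ α, A.mulVec (v α) = ev α • v α) ∧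
      (∀ i j, ∑ α, v α i * v α j = if i = j then 1 else 0) ∧
      ∀ α β, ∑ i, v α i * v β i = if α = β then 1 else 0 := by
  have hH : A.IsHermitian := by
    rw [Matrix.IsHermitian, Matrix.conjTranspose_eq_transpose_of_trivial]; exact hA
  refine ⟨fun α => hH.eigenvectorBasis α, hH.eigenvalues,
    fun α => hH.mulVec_eigenvectorBasis α, fun i j => ?_, fun α β => ?_⟩
  · have := congrFun (congrFun (Unitary.coe_mul_star_self hH.eigenvectorUnitary) i) j
    simpa [Matrix.mul_apply, Matrix.one_apply] using this
  · have := congrFun (congrFun (Unitary.coe_star_mul_self hH.eigenvectorUnitary) α) β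
    simpa [Matrix.mul_apply, Matrix.one_apply] using this

/-- For a delocalized matrix, a random relabelling of the weights makes all quadratic forms of unit
eigenvectors small. -/
theorem card_hasLargeObservable_le [Nonempty V] {A : Matrix V V ℝ} (hA : A.IsSymm) {B : ℝ}
    (hB : 0 < B) (hdel : Delocalized A B) {a : V → ℝ} (ha : ∑ i, a i = 0) {T : ℝ} (hT : 0 < T)
    (m : ℕ) [∀ π : Equiv.Perm V, Decidable (HasLargeObservable A (a ∘ π) T)] :
    ((Finset.univ.filter fun π : Equiv.Perm V => HasLargeObservable A (a ∘ π) T).card : ℝ)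
      ≤ Fintype.card V ^ 2 * (Fintype.card (Equiv.Perm V) *
        (8 * m * (B ^ 2 * ∑ i, a i ^ 2) / (T / (Fintype.card V * B)) ^ 2) ^ m) := by
  classical
  obtain ⟨v, ev, hev, hcomp, horth⟩ := exists_orthonormal_eigenvectors hA
  have hN : (0 : ℝ) < Fintype.card V := by simp [Fintype.card_pos]
  set T' := T / (Fintype.card V * B) with hT'
  have hT'0 : 0 < T' := by positivity
  have hunit : ∀ α, IsUnitEigenvector A (ev α) (v α) := fun α =>
    ⟨hev α, by simpa [pow_two] using horth α α⟩
  have hvB : ∀ α β i, |v α i * v β i| ≤ B := by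
    intro α β i
    have h1 := hdel _ _ (hunit α) i
    have h2 := hdel _ _ (hunit β) i
    rw [abs_le]
    constructor <;> nlinarith [sq_nonneg (v α i - v β i), sq_nonneg (v α i + v β i)]
  -- The normalised projection of the i-th coordinate vector onto the eigenspace is a unit
  -- eigenvector whose i-th squared entry is the i-th diagonal entry of the projector.
  -- Delocalization bounds this by B, and the trace of the projector is the multiplicity.
  have hmult : ∀ lam, ((Finset.univ.filter fun α => ev α = lam).card : ℝ)
      ≤ Fintype.card V * B := by
    intro lam
    set S := Finset.univ.filter fun α => ev α = lam with hS
    have hi : ∀ i, ∑ α ∈ S, v α i ^ 2 ≤ B := by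
      intro i
      set σ := ∑ α ∈ S, v α i ^ 2 with hσ
      have hσ0 : 0 ≤ σ := Finset.sum_nonneg fun _ _ => sq_nonneg _
      rcases hσ0.eq_or_lt with h | h
      · rw [← h]; exact hB.le
      have hs : 0 < Real.sqrt σ := Real.sqrt_pos.2 h
      have hsq : Real.sqrt σ ^ 2 = σ := Real.sq_sqrt hσ0
      set u : V → ℝ := fun j => (Real.sqrt σ)⁻¹ * ∑ α ∈ S, v α i * v α j with hu
      have hul : A.mulVec u = lam • u := by
        have e : u = (Real.sqrt σ)⁻¹ • ∑ α ∈ S, v α i • v α := by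
          ext j; simp [hu, Finset.sum_apply]
        rw [e, Matrix.mulVec_smul, Matrix.mulVec_sum, smul_comm lam, Finset.smul_sum (r := lam)]
        congr 1
        refine Finset.sum_congr rfl fun α hα => ?_
        rw [Matrix.mulVec_smul, hev, (Finset.mem_filter.1 hα).2, smul_comm]
      have hu1 : ∑ j, u j ^ 2 = 1 := by
        have e : ∑ j, (∑ α ∈ S, v α i * v α j) ^ 2 = σ := by
          simp only [pow_two (∑ α ∈ S, _), Finset.sum_mul_sum]
          rw [Finset.sum_comm]
          refine Finset.sum_congr rfl fun α hα => ?_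
          rw [Finset.sum_comm]
          have : ∀ β, ∑ j, v α i * v α j * (v β i * v β j)
              = if α = β then v α i * v β i else 0 := by
            intro β
            have := horth α β
            calc _ = v α i * v β i * ∑ j, v α j * v β j := by
                  rw [Finset.mul_sum]; exact Finset.sum_congr rfl fun j _ => by ring
              _ = _ := by rw [this]; split_ifs <;> simp
          simp only [this, Finset.sum_ite_eq, hα, if_true]
          ring
        simp only [hu, mul_pow, ← Finset.mul_sum, e, inv_pow, hsq]
        field_simp
      have := hdel lam u ⟨hul, hu1⟩ i
      have hui : u i = Real.sqrt σ := by
        have : ∑ α ∈ S, v α i * v α i = σ := by simp only [hσ, pow_two]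
        simp only [hu, this]
        rw [inv_mul_eq_div, div_eq_iff hs.ne', ← pow_two, hsq]
      rwa [hui, hsq] at this
    have : (S.card : ℝ) = ∑ i, ∑ α ∈ S, v α i ^ 2 := by
      rw [Finset.sum_comm, Finset.sum_congr rfl fun α _ => (hunit α).2]
      simp
    rw [this, ← Finset.card_univ, ← nsmul_eq_mul]
    exact Finset.sum_le_card_nsmul _ _ _ fun i _ => hi i
  -- The basis is fixed before π is drawn. If all its bilinear forms are at most T', then expanding
  -- u in the basis vectors of its eigenspace costs the squared ℓ¹ norm of the coefficients, at most
  -- the multiplicity by Cauchy-Schwarz.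
  have hsub : (Finset.univ.filter fun π : Equiv.Perm V => HasLargeObservable A (a ∘ π) T) ⊆
      (Finset.univ : Finset (V × V)).biUnion fun γ =>
        Finset.univ.filter fun π => T' < |permSum a (fun i => v γ.1 i * v γ.2 i) π| := by
    intro π hπ
    obtain ⟨lam, u, ⟨hul, hu1⟩, hlarge⟩ := (Finset.mem_filter.1 hπ).2
    simp only [Finset.mem_biUnion, Finset.mem_univ, true_and, Finset.mem_filter]
    by_contra hcon
    push Not at hcon
    set c : V → ℝ := fun α => ∑ j, v α j * u j with hc
    have hexp : ∀ i, u i = ∑ α, c α * v α i := by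
      intro i
      simp only [hc, Finset.sum_mul]
      rw [Finset.sum_comm]
      have : ∀ j, ∑ α, v α j * u j * v α i = if j = i then u j else 0 := by
        intro j
        calc _ = u j * ∑ α, v α j * v α i := by
              rw [Finset.mul_sum]; exact Finset.sum_congr rfl fun α _ => by ring
          _ = _ := by rw [hcomp]; split_ifs <;> simp
      simp [this]
    have hc0 : ∀ α, ev α ≠ lam → c α = 0 := by
      intro α hα
      have h1 : v α ⬝ᵥ A.mulVec u = A.mulVec (v α) ⬝ᵥ u := by
        rw [Matrix.dotProduct_mulVec, ← Matrix.mulVec_transpose, hA.eq]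
      rw [hul, hev, dotProduct_smul, smul_dotProduct] at h1
      have h2 : (lam - ev α) * c α = 0 := by
        have : c α = v α ⬝ᵥ u := rfl
        rw [this, sub_mul, sub_eq_zero]; exact h1
      rcases mul_eq_zero.1 h2 with h | h
      · exact absurd (sub_eq_zero.1 h).symm hα
      · exact h
    have hcsq : ∑ α, c α ^ 2 = 1 := by
      rw [← hu1]
      have : ∀ i, u i ^ 2 = ∑ α, c α * (v α i * u i) := by
        intro i
        rw [pow_two]
        nth_rewrite 1 [hexp i]
        rw [Finset.sum_mul]; exact Finset.sum_congr rfl fun α _ => by ring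
      simp only [this]
      rw [Finset.sum_comm]
      refine Finset.sum_congr rfl fun α _ => ?_
      rw [← Finset.mul_sum, pow_two]
    set S := Finset.univ.filter fun α => ev α = lam with hS
    have hcS : ∀ f : V → ℝ, ∑ α, |c α| * f α = ∑ α ∈ S, |c α| * f α := by
      intro f
      refine (Finset.sum_subset (Finset.subset_univ S) fun α _ hα => ?_).symm
      rw [hc0 α (by simpa [hS] using hα)]; simp
    have hobs : ∑ i, (a ∘ π) i * u i ^ 2
        = ∑ α, ∑ β, c α * c β * permSum a (fun i => v α i * v β i) π := by
      have : ∀ i, u i ^ 2 = ∑ α, ∑ β, c α * c β * (v α i * v β i) := by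
        intro i
        rw [pow_two, hexp i, Finset.sum_mul_sum]
        exact Finset.sum_congr rfl fun α _ => Finset.sum_congr rfl fun β _ => by ring
      simp only [this, permSum, Finset.mul_sum]
      rw [Finset.sum_comm]
      refine Finset.sum_congr rfl fun α _ => ?_
      rw [Finset.sum_comm]
      exact Finset.sum_congr rfl fun β _ => Finset.sum_congr rfl fun i _ => by
        simp only [Function.comp]; ring
    have hle : |∑ i, (a ∘ π) i * u i ^ 2| ≤ (∑ α, |c α|) ^ 2 * T' := by
      rw [hobs, pow_two, Finset.sum_mul_sum, Finset.sum_mul]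
      refine (Finset.abs_sum_le_sum_abs _ _).trans (Finset.sum_le_sum fun α _ => ?_)
      rw [Finset.sum_mul]
      refine (Finset.abs_sum_le_sum_abs _ _).trans (Finset.sum_le_sum fun β _ => ?_)
      rw [abs_mul, abs_mul]
      gcongr
      exact hcon (α, β)
    have hcl : (∑ α, |c α|) ^ 2 ≤ Fintype.card V * B := by
      have h1 := hcS fun _ => 1
      simp only [mul_one] at h1
      rw [h1]
      have h2 := sq_sum_le_card_mul_sum_sq (s := S) (f := fun α => |c α|)
      simp only [sq_abs] at h2
      have h3 : ∑ α ∈ S, c α ^ 2 ≤ 1 := by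
        rw [← hcsq]
        exact Finset.sum_le_sum_of_subset_of_nonneg (Finset.subset_univ S)
          fun _ _ _ => sq_nonneg _
      calc _ ≤ (S.card : ℝ) * ∑ α ∈ S, c α ^ 2 := h2
        _ ≤ (S.card : ℝ) * 1 := mul_le_mul_of_nonneg_left h3 (Nat.cast_nonneg _)
        _ ≤ _ := by rw [mul_one]; exact hmult lam
    have : (∑ α, |c α|) ^ 2 * T' ≤ T := by
      calc _ ≤ (Fintype.card V * B) * T' := by gcongr
        _ = T := by rw [hT']; field_simp
    linarith
  calc _ ≤ (((Finset.univ : Finset (V × V)).biUnion fun γ =>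
        Finset.univ.filter fun π => T' < |permSum a (fun i => v γ.1 i * v γ.2 i) π|).card : ℝ) := by
        exact_mod_cast Finset.card_le_card hsub
    _ ≤ ∑ γ : V × V, ((Finset.univ.filter fun π =>
        T' < |permSum a (fun i => v γ.1 i * v γ.2 i) π|).card : ℝ) := by
        exact_mod_cast Finset.card_biUnion_le
    _ ≤ Fintype.card (V × V) • (Fintype.card (Equiv.Perm V) *
        (8 * m * (B ^ 2 * ∑ i, a i ^ 2) / T' ^ 2) ^ m) := by
        rw [← Finset.card_univ (α := V × V)]
        exact Finset.sum_le_card_nsmul _ _ _ fun γ _ =>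
          card_permSum_gt_le ha (hvB γ.1 γ.2) hT'0 m
    _ = _ := by
        rw [nsmul_eq_mul, Fintype.card_prod]; push_cast; ring

end Eigenvector

/-! ### Invariance of the graph law under vertex permutations. -/

section Exchangeability

variable {V : Type*} [Fintype V]

theorem isUnitEigenvector_submatrix {A : Matrix V V ℝ} (π : Equiv.Perm V) {lam : ℝ} {u : V → ℝ}
    (h : IsUnitEigenvector A lam u) : IsUnitEigenvector (A.submatrix π π) lam (u ∘ π) := by
  refine ⟨?_, ?_⟩
  · ext i
    have := congrFun h.1 (π i)
    simp only [Matrix.mulVec, dotProduct, Matrix.submatrix_apply, Function.comp, Pi.smul_apply,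
      smul_eq_mul] at this ⊢
    rw [← this]
    exact Equiv.sum_comp π fun j => A (π i) j * u j
  · rw [← h.2]
    exact Equiv.sum_comp π fun j => u j ^ 2

theorem isUnitEigenvector_of_submatrix {A : Matrix V V ℝ} (π : Equiv.Perm V) {lam : ℝ} {u : V → ℝ}
    (h : IsUnitEigenvector (A.submatrix π π) lam u) : IsUnitEigenvector A lam (u ∘ π.symm) := by
  have := isUnitEigenvector_submatrix π.symm h
  simpa using this

theorem Delocalized.of_submatrix {A : Matrix V V ℝ} {B : ℝ} (π : Equiv.Perm V)
    (h : Delocalized (A.submatrix π π) B) : Delocalized A B := by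
  intro lam u hu i
  have := h lam _ (isUnitEigenvector_submatrix π hu) (π.symm i)
  simpa using this

theorem HasLargeObservable.of_submatrix {A : Matrix V V ℝ} {a : V → ℝ} {T : ℝ} (π : Equiv.Perm V)
    (h : HasLargeObservable (A.submatrix π π) a T) : HasLargeObservable A (a ∘ π.symm) T := by
  obtain ⟨lam, u, hu, hT⟩ := h
  refine ⟨lam, _, isUnitEigenvector_of_submatrix π hu, hT.trans_le (le_of_eq ?_)⟩
  congr 1
  exact (Equiv.sum_comp π.symm fun i => a i * u i ^ 2).symm

/-- The action of a permutation of the vertices on the edges. -/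
def edgePerm (π : Equiv.Perm V) : Equiv.Perm (Sym2 V) where
  toFun := Sym2.map π
  invFun := Sym2.map π.symm
  left_inv e := by simp [Sym2.map_map]
  right_inv e := by simp [Sym2.map_map]

omit [Fintype V] in
theorem adjacency_comp_edgePerm (c : ℝ) (X : Sym2 V → Bool) (π : Equiv.Perm V) :
    c • adjacency (X ∘ edgePerm π) = (c • adjacency X).submatrix π π := by
  ext i j
  simp only [adjacency, edgePerm, Matrix.smul_apply, Matrix.submatrix_apply, Function.comp,
    Equiv.coe_fn_mk, Sym2.map_mk]
  rfl

variable [DecidableEq V]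

/-- In an exchangeable random graph with delocalized eigenvectors, the quadratic forms of
eigenvectors with a given centred weight are small. -/
theorem bernoulliProb_hasLargeObservable_le [Nonempty V] {q : Sym2 V → ℝ} (h0 : ∀ e, 0 ≤ q e)
    (h1 : ∀ e, q e ≤ 1) (hq : ∀ (π : Equiv.Perm V) e, q (edgePerm π e) = q e) (c : ℝ) {B : ℝ}
    (hB : 0 < B) {a : V → ℝ} (ha : ∑ i, a i = 0) {T : ℝ} (hT : 0 < T) (m : ℕ) :
    bernoulliProb q {X | Delocalized (c • adjacency X) B ∧
        HasLargeObservable (c • adjacency X) a T}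
      ≤ Fintype.card V ^ 2 *
        (8 * m * (B ^ 2 * ∑ i, a i ^ 2) / (T / (Fintype.card V * B)) ^ 2) ^ m := by
  classical
  set S := {X : Sym2 V → Bool | Delocalized (c • adjacency X) B ∧
        HasLargeObservable (c • adjacency X) a T} with hS
  set ε := (Fintype.card V : ℝ) ^ 2 *
        (8 * m * (B ^ 2 * ∑ i, a i ^ 2) / (T / (Fintype.card V * B)) ^ 2) ^ m with hε
  have hε0 : 0 ≤ ε := by positivity
  have hM : (0 : ℝ) < Fintype.card (Equiv.Perm V) := by simp [Fintype.card_pos]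
  -- By invariance the probability is an average over relabellings of one graph; the bound is then
  -- proved graph by graph.
  have e1 : Fintype.card (Equiv.Perm V) * bernoulliProb q S
      = bernoulliExp q fun X => ∑ π : Equiv.Perm V, S.indicator 1 (X ∘ edgePerm π) := by
    have : ∀ π : Equiv.Perm V, bernoulliProb q S
        = bernoulliExp q fun X => S.indicator 1 (X ∘ edgePerm π) := fun π =>
      (bernoulliExp_comp_equiv (edgePerm π) (hq π) _).symm
    calc _ = ∑ _π : Equiv.Perm V, bernoulliProb q S := by
          rw [Finset.sum_const, Finset.card_univ, nsmul_eq_mul]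
      _ = ∑ π : Equiv.Perm V, bernoulliExp q fun X => S.indicator 1 (X ∘ edgePerm π) :=
        Finset.sum_congr rfl fun π _ => this π
      _ = _ := by
        simp only [bernoulliExp, Finset.mul_sum]
        rw [Finset.sum_comm]
  have e2 : ∀ X, ∑ π : Equiv.Perm V, S.indicator 1 (X ∘ edgePerm π)
      ≤ (Fintype.card (Equiv.Perm V) * ε) * (1 : ℝ) := by
    intro X
    rw [mul_one]
    by_cases hdel : Delocalized (c • adjacency X) B
    · have hcard := card_hasLargeObservable_le (smul_adjacency_isSymm c X) hB hdel ha hT m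
      calc _ ≤ ∑ π : Equiv.Perm V,
            (if HasLargeObservable (c • adjacency X) (a ∘ π.symm) T then (1 : ℝ) else 0) := by
            refine Finset.sum_le_sum fun π _ => ?_
            by_cases hπ : X ∘ edgePerm π ∈ S
            · have := hπ.2
              rw [adjacency_comp_edgePerm] at this
              rw [if_pos (HasLargeObservable.of_submatrix π this)]
              simp [hπ]
            · rw [Set.indicator_of_notMem hπ]
              split_ifs <;> norm_num
        _ = ∑ π : Equiv.Perm V,
            (if HasLargeObservable (c • adjacency X) (a ∘ π) T then (1 : ℝ) else 0) :=
            Fintype.sum_equiv (Equiv.inv (Equiv.Perm V)) _ _ fun π => rfl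
        _ = ((Finset.univ.filter fun π : Equiv.Perm V =>
              HasLargeObservable (c • adjacency X) (a ∘ π) T).card : ℝ) := by
            rw [Finset.sum_boole]
        _ ≤ _ := hcard.trans (le_of_eq (by rw [hε]; ring))
    · refine le_trans (le_of_eq (Finset.sum_eq_zero fun π _ => ?_)) (by positivity)
      rw [Set.indicator_of_notMem]
      rintro ⟨hd, _⟩
      rw [adjacency_comp_edgePerm] at hd
      exact hdel (Delocalized.of_submatrix π hd)
  have e3 : Fintype.card (Equiv.Perm V) * bernoulliProb q S
      ≤ Fintype.card (Equiv.Perm V) * ε := by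
    rw [e1]
    refine (bernoulliExp_mono h0 h1 e2).trans ?_
    rw [bernoulliExp_mul_left, bernoulliExp_const_one, mul_one]
  exact le_of_mul_le_mul_left e3 hM

end Exchangeability

/-! ### Delocalization with overwhelming probability. -/

section Delocalization

variable {V : Type*} [Fintype V] [DecidableEq V]

-- Compare both sides of the eigenvalue equation at a coordinate of maximal modulus. This crude
-- bound keeps the energy grid polynomial in size while covering every eigenvalue, outliers
-- included.
omit [DecidableEq V] in
theorem abs_eigenvalue_le {A : Matrix V V ℝ} (hA : ∀ i j, |A i j| ≤ 1) {lam : ℝ} {u : V → ℝ}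
    (h : IsUnitEigenvector A lam u) : |lam| ≤ Fintype.card V := by
  have hne : Nonempty V := by
    by_contra hV
    rw [not_nonempty_iff] at hV
    have := h.2
    simp at this
  obtain ⟨i, hi⟩ := Finite.exists_max fun i => |u i|
  have hpos : 0 < |u i| := by
    by_contra hc
    have h0 : ∀ j, u j = 0 := fun j => by
      have := hi j
      exact abs_eq_zero.1 (le_antisymm (by linarith) (abs_nonneg _))
    have := h.2
    simp [h0] at this
  have h1 := congrFun h.1 i
  simp only [Matrix.mulVec, dotProduct, Pi.smul_apply, smul_eq_mul] at h1
  have h2 : |lam| * |u i| ≤ Fintype.card V * |u i| := by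
    rw [← abs_mul, ← h1, ← nsmul_eq_mul, ← Finset.card_univ]
    refine (Finset.abs_sum_le_sum_abs _ _).trans (Finset.sum_le_card_nsmul _ _ _ fun j _ => ?_)
    rw [abs_mul]
    calc _ ≤ 1 * |u i| := mul_le_mul (hA i j) (hi j) (abs_nonneg _) zero_le_one
      _ = _ := one_mul _
  exact le_of_mul_le_mul_right h2 hpos

/-- The failure of delocalization forces some row to be atypical at some energy and scale. -/
theorem delocalized_of_notMem_atypicalRow {c p a₁ a₂ a₃ : ℝ} (hp0 : 0 < p) (hp1 : p ≤ 1 / 2)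
    (hc0 : 0 ≤ c) (hc1 : c ≤ 1) (hc : c ^ 2 * (p * (1 - p) * Fintype.card V) = 1)
    (hε : 74 * (c * a₃) ≤ 1)
    (hε' : 74 * (c + c ^ 2 * (a₁ + a₂) + 2 * (74 * (c * a₃) ^ 2 + 74 / Fintype.card V)) ≤ 1 / 2)
    (X : Sym2 V → Bool) (s : ℕ)
    (hX : ∀ t ∈ Finset.Icc (-(Fintype.card V * 2 ^ s : ℤ)) (Fintype.card V * 2 ^ s),
      ∀ r ∈ Finset.range (s + 1), ∀ i,
      X ∉ atypicalRow c p a₁ a₂ a₃ 74 ⟨t * (1 / 2) ^ s, (1 / 2) ^ r⟩ i) :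
    Delocalized (c • adjacency X) (74 * (1 / 2) ^ s) := by
  intro lam u hu i
  have hlam : |lam| ≤ Fintype.card V := by
    refine abs_eigenvalue_le (fun i j => ?_) hu
    simp only [Matrix.smul_apply, adjacency, smul_eq_mul, abs_mul, abs_of_nonneg hc0]
    split_ifs <;> simp [hc1]
  have h2s : (0 : ℝ) < 2 ^ s := by positivity
  have hpow : ((1 : ℝ) / 2) ^ s * 2 ^ s = 1 := by rw [← mul_pow]; norm_num
  set η : ℝ := (1 / 2) ^ s with hη
  have hη0 : 0 < η := by positivity
  -- The grid has spacing equal to the final scale, and an energy within that distance of the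
  -- eigenvalue is enough; no continuity in the spectral parameter is needed.
  set t : ℤ := ⌊lam * 2 ^ s⌋ with ht
  have h1 : (t : ℝ) ≤ lam * 2 ^ s := Int.floor_le _
  have h2 : lam * 2 ^ s < t + 1 := Int.lt_floor_add_one _
  have hl := abs_le.1 hlam
  have htm : t ∈ Finset.Icc (-(Fintype.card V * 2 ^ s : ℤ)) (Fintype.card V * 2 ^ s) := by
    rw [Finset.mem_Icc]
    constructor
    · rw [ht, Int.le_floor]
      push_cast
      nlinarith
    · have : (t : ℝ) ≤ ((Fintype.card V * 2 ^ s : ℤ) : ℝ) := by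
        push_cast
        nlinarith
      exact_mod_cast this
  have hG := greenBounded_of_notMem_atypicalRow hp0 hp1 hc0 hc hε hε' X (t * η) s
    fun r hr i => hX t htm r (Finset.mem_range.2 (Nat.lt_succ_of_le hr)) i
  have hz : 0 < (⟨t * η, η⟩ : ℂ).im := hη0
  have := sq_eigenvector_le (smul_adjacency_isSymm c X) hz hu.1 hu.2 (b := 37) ?_ i (hG.1 i i)
  · refine this.trans (le_of_eq ?_)
    show 2 * η * 37 = 74 * η
    ring
  · show |lam - t * η| ≤ η
    have e : lam = lam * 2 ^ s * η := by rw [mul_assoc, mul_comm _ η, hpow, mul_one]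
    have e1 : lam - t * η = (lam * 2 ^ s - t) * η := by rw [sub_mul, ← e]
    rw [e1, abs_mul, abs_of_pos hη0]
    have : |lam * 2 ^ s - t| ≤ 1 := by rw [abs_le]; constructor <;> linarith
    calc _ ≤ 1 * η := by gcongr
      _ = η := one_mul _

theorem bernoulliProb_not_delocalized_le {q : Sym2 V → ℝ} (h0 : ∀ e, 0 ≤ q e) (h1 : ∀ e, q e ≤ 1)
    {p : ℝ} (hq : ∀ i j, j ≠ i → q s(i, j) = p) {c τ δ t : ℝ} {l m : ℕ} (hp0 : 0 < p)
    (hp1 : p ≤ 1 / 2) (hc0 : 0 ≤ c) (hc1 : c ≤ 1)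
    (hc : c ^ 2 * (p * (1 - p) * Fintype.card V) = 1)
    (hε : 74 * (c * (l * 74 + δ * (p * Fintype.card V + τ))) ≤ 1)
    (hε' : 74 * (c + c ^ 2 * (2 * τ + (4 * l * m * 74 + δ * (p * Fintype.card V + τ) ^ 2))
      + 2 * (74 * (c * (l * 74 + δ * (p * Fintype.card V + τ))) ^ 2 + 74 / Fintype.card V))
        ≤ 1 / 2)
    (hδ : 0 < δ) (ht : 0 ≤ t) (ht1 : t * 74 ≤ 1) {s : ℕ} (hs : 2 ^ s ≤ Fintype.card V) {ε : ℝ}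
    (hrow : 6 * Real.exp (t ^ 2 * (p * Fintype.card V) * 74 ^ 2 - t * τ)
        + Fintype.card V * (74 / (1 / 2) ^ s / δ ^ 2 * p) ^ l
        + (Fintype.card V * (74 / (1 / 2) ^ s / δ ^ 2) * p ^ 2) ^ m ≤ ε) :
    bernoulliProb q {X | ¬ Delocalized (c • adjacency X) (74 * (1 / 2) ^ s)}
      ≤ 3 * Fintype.card V ^ 4 * ε := by
  set N := Fintype.card V with hN
  set a₁ := 2 * τ
  set a₂ := 4 * l * m * 74 + δ * (p * N + τ) ^ 2
  set a₃ := l * 74 + δ * (p * N + τ)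
  set J := Finset.Icc (-(N * 2 ^ s : ℤ)) (N * 2 ^ s) ×ˢ Finset.range (s + 1) ×ˢ
    (Finset.univ : Finset V) with hJ
  have hsub : {X | ¬ Delocalized (c • adjacency X) (74 * (1 / 2) ^ s)} ⊆
      ⋃ κ ∈ J, atypicalRow c p a₁ a₂ a₃ 74 ⟨κ.1 * (1 / 2) ^ s, (1 / 2) ^ κ.2.1⟩ κ.2.2 := by
    intro X hX
    by_contra hn
    simp only [Set.mem_iUnion, not_exists] at hn
    refine hX (delocalized_of_notMem_atypicalRow hp0 hp1 hc0 hc1 hc hε hε' X s ?_)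
    intro t ht r hr i
    exact hn (t, r, i) (by
      rw [hJ, Finset.mem_product, Finset.mem_product]; exact ⟨ht, hr, Finset.mem_univ i⟩)
  have hε0 : 0 ≤ ε := le_trans (by positivity) hrow
  have hs1 : s + 1 ≤ N := Nat.succ_le_of_lt (lt_of_lt_of_le Nat.lt_two_pow_self hs)
  -- At most 3N² energies, N scales and N rows.
  have hcard : (J.card : ℝ) ≤ 3 * N ^ 4 := by
    have e : J.card ≤ (3 * N ^ 2) * (N * N) := by
      rw [hJ, Finset.card_product, Finset.card_product, Int.card_Icc, Finset.card_range,
        Finset.card_univ]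
      refine Nat.mul_le_mul ?_ (Nat.mul_le_mul hs1 le_rfl)
      have e1 : ((N : ℤ) * 2 ^ s + 1 - -(N * 2 ^ s)).toNat = 2 * (N * 2 ^ s) + 1 := by
        have : ((N : ℤ) * 2 ^ s + 1 - -(N * 2 ^ s)) = ((2 * (N * 2 ^ s) + 1 : ℕ) : ℤ) := by
          push_cast; ring
        rw [this, Int.toNat_natCast]
      rw [e1]
      have : N * 2 ^ s ≤ N ^ 2 := by rw [pow_two]; exact Nat.mul_le_mul le_rfl hs
      have : 1 ≤ N ^ 2 := Nat.one_le_pow _ _ (by omega)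
      omega
    calc (J.card : ℝ) ≤ (((3 * N ^ 2) * (N * N) : ℕ) : ℝ) := by exact_mod_cast e
      _ = _ := by push_cast; ring
  refine (bernoulliProb_mono h0 h1 hsub).trans ((bernoulliProb_biUnion_le h0 h1 _ _).trans ?_)
  calc _ ≤ J.card • ε := by
        refine Finset.sum_le_card_nsmul _ _ _ fun κ hκ => ?_
        refine le_trans (bernoulliProb_atypicalRow_le h0 h1 hq hp0.le (by linarith) c
          (z := ⟨κ.1 * (1 / 2) ^ s, (1 / 2) ^ κ.2.1⟩) (by simp) (by norm_num) hδ ht ht1 τ l m κ.2.2)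
          (le_trans ?_ hrow)
        have hr : κ.2.1 ≤ s := by
          rw [hJ, Finset.mem_product, Finset.mem_product] at hκ
          exact Nat.lt_succ_iff.1 (Finset.mem_range.1 hκ.2.1)
        have him : ((1 : ℝ) / 2) ^ s ≤ (1 / 2) ^ κ.2.1 :=
          pow_le_pow_of_le_one (by norm_num) (by norm_num) hr
        have him0 : (0 : ℝ) < (1 / 2) ^ s := by positivity
        simp only
        gcongr
    _ = J.card * ε := nsmul_eq_mul _ _
    _ ≤ _ := by gcongr

end Delocalization

/-! ### Thresholds for N. -/

section Asymptotics

open Filter Topology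

theorem eventually_const_mul_pow_le_exp (C : ℝ) (k : ℕ) {b : ℝ} (hb : 0 < b) :
    ∀ᶠ x : ℝ in atTop, C * x ^ k ≤ Real.exp (b * x) := by
  have h1 := (Real.tendsto_pow_mul_exp_neg_atTop_nhds_zero k).comp
    (tendsto_id.const_mul_atTop hb)
  have h2 := h1.const_mul (C / b ^ k)
  rw [mul_zero] at h2
  filter_upwards [h2.eventually_le_const (zero_lt_one : (0 : ℝ) < 1)] with x hx
  simp only [Function.comp, id, mul_pow] at hx
  rw [Real.exp_neg] at hx
  have : C / b ^ k * (b ^ k * x ^ k * (Real.exp (b * x))⁻¹) = C * x ^ k / Real.exp (b * x) := by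
    field_simp
  rw [this, div_le_one (Real.exp_pos _)] at hx
  exact hx

/-- With δ = x^(-42) and pN ≤ x^40, the exponent is 164 = 84 + 40 + 40: from δ^(-2), from pN, and
from one further factor pN in the matching bound. -/
theorem exists_log_threshold (M : ℝ) : ∃ N₀ : ℕ, ∀ N : ℕ, N₀ ≤ N →
    1000000 ≤ Real.log N ∧
    74 * Real.sqrt (Real.log N) ^ 164 ≤ Real.exp (1 / 8 * Real.sqrt (Real.log N)) ∧
    M * Real.sqrt (Real.log N) ^ 1 ≤ Real.exp (7 / 8 * Real.sqrt (Real.log N)) := by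
  have h := (Real.tendsto_sqrt_atTop.comp Real.tendsto_log_atTop).comp
    (tendsto_natCast_atTop_atTop (R := ℝ))
  have h1 := h.eventually (eventually_const_mul_pow_le_exp 74 164 (by norm_num : (0 : ℝ) < 1 / 8))
  have h2 := h.eventually (eventually_const_mul_pow_le_exp M 1 (by norm_num : (0 : ℝ) < 7 / 8))
  have h3 := (Real.tendsto_log_atTop.comp (tendsto_natCast_atTop_atTop (R := ℝ))).eventually
    (eventually_ge_atTop 1000000)
  obtain ⟨N₀, hN₀⟩ := eventually_atTop.1 (h3.and (h1.and h2))
  exact ⟨N₀, fun N hN => hN₀ N hN⟩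

end Asymptotics

/-! ### Numerical choice of the parameters. -/

section Parameters

/-- The error terms in Schur's formula are small for supercritical sparse graphs. -/
theorem schur_errors_small {N p c x D m : ℝ} (hx : 1000 ≤ x) (hD : 1 ≤ D) (hp0 : 0 < p)
    (hp1 : p ≤ 1 / 2) (hN : 1000000 ≤ N) (hd : (16000000 * D) ^ 2 * x ^ 2 ≤ p * N)
    (hd' : p * N ≤ x ^ 40) (hc0 : 0 ≤ c) (hc : c ^ 2 * (p * (1 - p) * N) = 1) (hm0 : 0 ≤ m)
    (hm : m ≤ 16 * D * x) :
    c ≤ 1 ∧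
    74 * (c * (m * 74 + 1 / x ^ 42 * (p * N + p * N / 4000))) ≤ 1 ∧
    74 * (c + c ^ 2 * (2 * (p * N / 4000) + (4 * m * m * 74
      + 1 / x ^ 42 * (p * N + p * N / 4000) ^ 2))
      + 2 * (74 * (c * (m * 74 + 1 / x ^ 42 * (p * N + p * N / 4000))) ^ 2 + 74 / N)) ≤ 1 / 2 := by
  set d := p * N with hdef
  have hd0 : 0 < d := by positivity
  have hcd : c ^ 2 * d ≤ 2 := by
    have : c ^ 2 * d * (1 - p) = 1 := by
      calc _ = c ^ 2 * (p * (1 - p) * N) := by rw [hdef]; ring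
        _ = 1 := hc
    nlinarith [mul_nonneg (sq_nonneg c) hd0.le]
  have hx2 : 1000000 ≤ x ^ 2 := by nlinarith
  -- The lower bound on pN enters here: 16000000 = 16·10⁶ makes m² at most 10⁻¹² pN, so the large
  -- pairs are harmless after rescaling.
  have hmd : m ^ 2 * 1000000000000 ≤ d := by
    have : m ^ 2 ≤ (16 * D * x) ^ 2 := by gcongr
    nlinarith
  have hcm : c * m ≤ 2 / 1000000 := by
    have h1 : (c * m) ^ 2 * 1000000000000 ≤ 2 := by
      rw [mul_pow]
      calc c ^ 2 * m ^ 2 * 1000000000000 = c ^ 2 * (m ^ 2 * 1000000000000) := by ring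
        _ ≤ c ^ 2 * d := by gcongr
        _ ≤ 2 := hcd
    refine abs_le_of_sq_le_sq' ?_ (by norm_num) |>.2
    linarith
  have hd1 : 1000000000000 ≤ d := by
    refine le_trans ?_ hd
    have : 1 ≤ D ^ 2 := one_le_pow₀ hD
    nlinarith
  have hc1 : c ≤ 2 / 1000000 := by
    refine abs_le_of_sq_le_sq' ?_ (by norm_num) |>.2
    nlinarith [mul_nonneg (sq_nonneg c) hd0.le, sq_nonneg c]
  have hxp : (0 : ℝ) < x := by linarith
  set δ := 1 / x ^ 42 with hδ
  have hδ0 : 0 < δ := by positivity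
  -- The upper bound on pN enters here: it makes all pairs below the threshold δ negligible.
  have hdδ : d * δ ≤ 1 / 1000000 := by
    calc d * δ ≤ x ^ 40 * δ := by gcongr
      _ = 1 / x ^ 2 := by rw [hδ]; field_simp
      _ ≤ 1 / 1000000 := by gcongr
  have hlin : c * (m * 74 + δ * (d + d / 4000)) ≤ 2 / 10000 := by
    have e : c * (m * 74 + δ * (d + d / 4000)) = 74 * (c * m) + c * (d * δ) * (1 + 1 / 4000) := by
      ring
    have h2 : c * (d * δ) ≤ 1 * (1 / 1000000) := by
      have : c ≤ 1 := by linarith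
      gcongr
    rw [e]; linarith
  have hlin0 : 0 ≤ c * (m * 74 + δ * (d + d / 4000)) := by positivity
  have hq : c ^ 2 * (2 * (d / 4000) + (4 * m * m * 74 + δ * (d + d / 4000) ^ 2)) ≤ 2 / 1000 := by
    have e : c ^ 2 * (2 * (d / 4000) + (4 * m * m * 74 + δ * (d + d / 4000) ^ 2))
        = c ^ 2 * d / 2000 + 296 * (c * m) ^ 2 + (c ^ 2 * d) * (d * δ) * (1 + 1 / 4000) ^ 2 := by
      ring
    have h1 : (c * m) ^ 2 ≤ (2 / 1000000) ^ 2 := by gcongr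
    have h2 : (c ^ 2 * d) * (d * δ) ≤ 2 * (1 / 1000000) := by gcongr
    rw [e]; nlinarith
  have hsq : (c * (m * 74 + δ * (d + d / 4000))) ^ 2 ≤ (2 / 10000) ^ 2 := by gcongr
  have hNinv : 74 / N ≤ 74 / 1000000 := by gcongr
  refine ⟨by linarith, by linarith, ?_⟩
  linarith

/-- A row is typical with overwhelming probability for supercritical sparse graphs. -/
theorem row_probability_le {N p x D η : ℝ} {m : ℕ} (hx : 1000 ≤ x) (hD : 1 ≤ D) (hp0 : 0 < p)
    (hN : N = Real.exp (x ^ 2)) (hd : (16000000 * D) ^ 2 * x ^ 2 ≤ p * N)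
    (hd' : p * N ≤ x ^ 40) (hm : 8 * D * x ≤ m)
    (hη : Real.exp (1 / 4 * x) / N ≤ η)
    (hexp : 74 * x ^ 164 ≤ Real.exp (1 / 8 * x)) :
    6 * Real.exp ((1 / 43808000) ^ 2 * (p * N) * 74 ^ 2 - 1 / 43808000 * (p * N / 4000))
        + N * (74 / η / (1 / x ^ 42) ^ 2 * p) ^ m
        + (N * (74 / η / (1 / x ^ 42) ^ 2) * p ^ 2) ^ m
      ≤ 8 * N * Real.exp (-(D * x ^ 2)) := by
  have hxp : (0 : ℝ) < x := by linarith
  have hN1 : 1 ≤ N := by rw [hN]; exact Real.one_le_exp (by positivity)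
  have hN0 : 0 < N := by linarith
  have hη0 : 0 < η := lt_of_lt_of_le (by positivity) hη
  -- The choice η ≥ exp(x/4)/N gives a gain exp(-x/4), half of which absorbs the powers of x. The
  -- m-th power with m ≥ 8Dx then reaches exp(-Dx²) = N^(-D).
  have hbase : 74 / η / (1 / x ^ 42) ^ 2 * p * x ^ 40 ≤ Real.exp (-(1 / 8 * x)) := by
    have h1 : 1 / η ≤ N * Real.exp (-(1 / 4 * x)) := by
      rw [Real.exp_neg, ← div_eq_mul_inv, div_le_div_iff₀ hη0 (Real.exp_pos _)]
      rw [div_le_iff₀ hN0] at hη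
      linarith
    have e1 : 74 / η / (1 / x ^ 42) ^ 2 * p * x ^ 40 = 1 / η * (74 * p * x ^ 124) := by
      field_simp
    rw [e1]
    calc _ ≤ N * Real.exp (-(1 / 4 * x)) * (74 * p * x ^ 124) := by gcongr
      _ = Real.exp (-(1 / 4 * x)) * (74 * (p * N) * x ^ 124) := by ring
      _ ≤ Real.exp (-(1 / 4 * x)) * (74 * x ^ 40 * x ^ 124) := by gcongr
      _ = Real.exp (-(1 / 4 * x)) * (74 * x ^ 164) := by ring
      _ ≤ Real.exp (-(1 / 4 * x)) * Real.exp (1 / 8 * x) := by gcongr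
      _ = _ := by rw [← Real.exp_add]; congr 1; ring
  have hb0 : 0 ≤ 74 / η / (1 / x ^ 42) ^ 2 * p := by positivity
  have hpow : Real.exp (-(1 / 8 * x)) ^ m ≤ Real.exp (-(D * x ^ 2)) := by
    rw [← Real.exp_nat_mul, Real.exp_le_exp]
    nlinarith
  have h2 : (74 / η / (1 / x ^ 42) ^ 2 * p) ^ m ≤ Real.exp (-(D * x ^ 2)) := by
    refine le_trans ?_ hpow
    gcongr
    refine le_trans ?_ hbase
    exact le_mul_of_one_le_right hb0 (one_le_pow₀ (by linarith))
  have h3 : (N * (74 / η / (1 / x ^ 42) ^ 2) * p ^ 2) ^ m ≤ Real.exp (-(D * x ^ 2)) := by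
    refine le_trans ?_ hpow
    gcongr
    refine le_trans ?_ hbase
    calc _ = 74 / η / (1 / x ^ 42) ^ 2 * p * (p * N) := by ring
      _ ≤ _ := by gcongr
  -- The value 43808000 = 2·4000·74² minimises the Chernoff exponent for deviation pN/4000.
  have h1 : Real.exp ((1 / 43808000) ^ 2 * (p * N) * 74 ^ 2 - 1 / 43808000 * (p * N / 4000))
      ≤ Real.exp (-(D * x ^ 2)) := by
    rw [Real.exp_le_exp]
    have : D * x ^ 2 ≤ D ^ 2 * x ^ 2 := by
      gcongr
      nlinarith
    nlinarith
  have hν := Real.exp_pos (-(D * x ^ 2))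
  calc _ ≤ 6 * Real.exp (-(D * x ^ 2)) + N * Real.exp (-(D * x ^ 2))
        + Real.exp (-(D * x ^ 2)) := by gcongr
    _ ≤ _ := by nlinarith

/-- The probability that a random relabelling produces a large quadratic form is small. -/
theorem permutation_probability_le {N x D B σ T : ℝ} {m : ℕ} (hx : 1000 ≤ x) (hD : 1 ≤ D)
    (hN0 : 0 < N) (hm : 8 * D * x ≤ m) (hm' : m ≤ 16 * D * x) (hB0 : 0 < B)
    (hB : N * B ≤ 148 * Real.exp (1 / 4 * x)) (hσ : 0 < σ)
    (hT : T = Real.exp x / N * Real.sqrt σ)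
    (hexp : 128 * 148 ^ 4 * D * x ≤ Real.exp (7 / 8 * x)) :
    N ^ 2 * (8 * m * (B ^ 2 * σ) / (T / (N * B)) ^ 2) ^ m ≤ N ^ 2 * Real.exp (-(D * x ^ 2)) := by
  have hxp : (0 : ℝ) < x := by linarith
  have hpow : Real.exp (-(1 / 8 * x)) ^ m ≤ Real.exp (-(D * x ^ 2)) := by
    rw [← Real.exp_nat_mul, Real.exp_le_exp]
    nlinarith
  have hs : 0 < Real.sqrt σ := Real.sqrt_pos.2 hσ
  have hs2 : Real.sqrt σ ^ 2 = σ := Real.sq_sqrt hσ.le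
  gcongr
  refine le_trans ?_ hpow
  have hT0 : 0 < T := by rw [hT]; positivity
  gcongr
  -- The weights cancel, leaving (NB)⁴/exp(2x). Since (NB)⁴ is of order exp x, this explains the
  -- final scale exp(x/4)/N.
  have e : ∀ r : ℝ, r ≠ 0 → 8 * m * (B ^ 2 * r ^ 2) / (Real.exp x / N * r / (N * B)) ^ 2
      = 8 * m * (N * B) ^ 4 / Real.exp x ^ 2 := fun r hr => by field_simp
  have e1 := e _ hs.ne'
  rw [hs2, ← hT] at e1
  rw [e1]
  have e2 : Real.exp (1 / 4 * x) ^ 4 = Real.exp x := by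
    rw [← Real.exp_nat_mul]; congr 1; push_cast; ring
  rw [div_le_iff₀ (by positivity)]
  calc 8 * m * (N * B) ^ 4 ≤ 8 * (16 * D * x) * (148 * Real.exp (1 / 4 * x)) ^ 4 := by gcongr
    _ = 128 * 148 ^ 4 * D * x * Real.exp x := by rw [mul_pow, e2]; ring
    _ ≤ Real.exp (7 / 8 * x) * Real.exp x := by gcongr
    _ = Real.exp (-(1 / 8 * x)) * Real.exp x ^ 2 := by
        rw [pow_two, ← Real.exp_add, ← Real.exp_add, ← Real.exp_add]; congr 1; ring

theorem le_half_of_mul_le_pow {N p x : ℝ} (hx : 1000 ≤ x) (hN : N = Real.exp (x ^ 2))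
    (hd : p * N ≤ x ^ 40) (hexp : 74 * x ^ 164 ≤ Real.exp (1 / 8 * x)) : p ≤ 1 / 2 := by
  have hN0 : 0 < N := by rw [hN]; exact Real.exp_pos _
  have h1 : 74 * x ^ 40 ≤ N := by
    rw [hN]
    calc 74 * x ^ 40 ≤ 74 * x ^ 164 := by
          gcongr
          · linarith
          · norm_num
      _ ≤ _ := hexp
      _ ≤ _ := by rw [Real.exp_le_exp]; nlinarith
  have h2 : 0 ≤ x ^ 40 := by positivity
  refine le_of_mul_le_mul_right (a := N) ?_ hN0
  linarith

theorem union_bound_arith {N r : ℝ} (hN : 1000000 ≤ N) (hr : 0 ≤ r) :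
    3 * N ^ 4 * (8 * N * (r / N ^ 8)) + N ^ 2 * (r / N ^ 8) ≤ r := by
  have hN0 : 0 < N := by linarith
  have e : 3 * N ^ 4 * (8 * N * (r / N ^ 8)) + N ^ 2 * (r / N ^ 8)
      = r * (24 / N ^ 3 + 1 / N ^ 6) := by
    field_simp
    ring
  have h : ∀ k : ℕ, k ≠ 0 → (100 : ℝ) ≤ N ^ k := fun k hk =>
    le_trans (by linarith) (le_self_pow₀ (by linarith : 1 ≤ N) hk)
  have h3 : 24 / N ^ 3 ≤ 24 / 100 := by gcongr; exact h 3 (by norm_num)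
  have h6 : 1 / N ^ 6 ≤ 1 / 100 := by gcongr; exact h 6 (by norm_num)
  rw [e]
  exact mul_le_of_le_one_right hr (by linarith)

end Parameters

/-! ### The estimate for the Bernoulli model. -/

section Model

/-- Edge probabilities of the Erdős–Rényi graph, with loops of probability `q₀`. -/
noncomputable def edgeProb (N : ℕ) (p q₀ : ℝ) (e : Sym2 (Fin N)) : ℝ :=
  open Classical in if e.IsDiag then q₀ else p

/-- The parameters are used with D + 8 in place of D: the spare N^(-8) absorbs the polynomial losses
of the union bounds. -/
theorem bernoulliProb_hasLargeObservable_le_rpow {N : ℕ} {D p q₀ : ℝ} (hD : 0 < D)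
    (hlog : 1000000 ≤ Real.log N)
    (hexp1 : 74 * Real.sqrt (Real.log N) ^ 164 ≤ Real.exp (1 / 8 * Real.sqrt (Real.log N)))
    (hexp2 : 128 * 148 ^ 4 * (D + 8) * Real.sqrt (Real.log N) ^ 1
      ≤ Real.exp (7 / 8 * Real.sqrt (Real.log N)))
    (hp0 : 0 < p) (hp1 : p < 1) (hq0 : 0 ≤ q₀) (hq1 : q₀ ≤ 1)
    (hd : (16000000 * (D + 8)) ^ 2 * Real.log N ≤ p * N)
    (hd' : Real.sqrt (p * N) ≤ Real.log N ^ 10) {a : Fin N → ℝ} (ha : ∑ i, a i = 0)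
    (ha0 : 0 < ∑ i, a i ^ 2) :
    bernoulliProb (edgeProb N p q₀) {X | HasLargeObservable
        (Real.sqrt (1 / (p * (1 - p) * N)) • adjacency X) a
        (Real.exp (Real.sqrt (Real.log N)) / N * Real.sqrt (∑ i, a i ^ 2))}
      ≤ (N : ℝ) ^ (-D) := by
  classical
  set x := Real.sqrt (Real.log N) with hxdef
  have hx2 : x ^ 2 = Real.log N := Real.sq_sqrt (by linarith)
  have hx : 1000 ≤ x := Real.le_sqrt_of_sq_le (by linarith)
  have hxp : 0 < x := by linarith
  have hNpos : (0 : ℝ) < N := by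
    rcases Nat.eq_zero_or_pos N with h | h
    · rw [h] at hlog; norm_num at hlog
    · exact_mod_cast h
  have hNexp : (N : ℝ) = Real.exp (x ^ 2) := by rw [hx2, Real.exp_log hNpos]
  have hNbig : 1000000 ≤ (N : ℝ) := by
    rw [hNexp]
    have := Real.add_one_le_exp (x ^ 2)
    linarith
  have hne : Nonempty (Fin N) := Fin.pos_iff_nonempty.1 (by exact_mod_cast hNpos)
  rw [← hx2] at hd
  have hd'' : p * N ≤ x ^ 40 := by
    have h1 : 0 ≤ p * N := by positivity
    rw [← Real.sq_sqrt h1]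
    calc Real.sqrt (p * N) ^ 2 ≤ (Real.log N ^ 10) ^ 2 := by gcongr
      _ = x ^ 40 := by rw [← hx2]; ring
  have hphalf : p ≤ 1 / 2 := le_half_of_mul_le_pow hx hNexp hd'' hexp1
  set c := Real.sqrt (1 / (p * (1 - p) * N)) with hcdef
  have h1p : 0 < 1 - p := by linarith
  have hc0 : 0 ≤ c := Real.sqrt_nonneg _
  have hc : c ^ 2 * (p * (1 - p) * N) = 1 := by
    rw [hcdef, Real.sq_sqrt (by positivity)]
    field_simp
  set m := ⌈8 * (D + 8) * x⌉₊ with hmdef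
  have hm : 8 * (D + 8) * x ≤ m := Nat.le_ceil _
  have hm' : (m : ℝ) ≤ 16 * (D + 8) * x := by
    have := Nat.ceil_lt_add_one (a := 8 * (D + 8) * x) (by positivity)
    have : 1 ≤ (D + 8) * x := one_le_mul_of_one_le_of_one_le (by linarith) (by linarith)
    linarith
  have hD1 : 1 ≤ D + 8 := by linarith
  obtain ⟨hc1, hε, hε'⟩ := schur_errors_small hx hD1 hp0 hphalf hNbig hd hd'' hc0 hc
    (Nat.cast_nonneg m) hm'
  -- The final dyadic scale lies between exp(x/4)/N and twice that value.
  obtain ⟨s, hs1, hs2⟩ := exists_nat_pow_near_of_lt_one (x := Real.exp (1 / 4 * x) / N)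
    (y := (1 / 2 : ℝ)) (by positivity) (by
      rw [div_le_one hNpos, hNexp, Real.exp_le_exp]; nlinarith) (by norm_num) (by norm_num)
  have hs : 2 ^ s ≤ N := by
    have h1 : (1 : ℝ) ≤ Real.exp (1 / 4 * x) := Real.one_le_exp (by positivity)
    have h2 : 1 / (N : ℝ) ≤ (1 / 2) ^ s := le_trans (by gcongr) hs2
    rw [one_div_pow, div_le_div_iff₀ hNpos (by positivity)] at h2
    have : (2 : ℝ) ^ s ≤ N := by linarith
    exact_mod_cast this
  set q := edgeProb N p q₀ with hq
  have h0 : ∀ e, 0 ≤ q e := fun e => by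
    rw [hq, edgeProb]; split_ifs <;> linarith
  have h1 : ∀ e, q e ≤ 1 := fun e => by
    rw [hq, edgeProb]; split_ifs <;> linarith
  have hqp : ∀ i j, j ≠ i → q s(i, j) = p := fun i j hij => by
    rw [hq, edgeProb, if_neg]; simpa using hij.symm
  have hqperm : ∀ (π : Equiv.Perm (Fin N)) e, q (edgePerm π e) = q e := fun π e => by
    have : (edgePerm π e).IsDiag ↔ e.IsDiag := Sym2.isDiag_map π.injective
    rw [hq, edgeProb, edgeProb]
    simp only [this]
  have hrow := row_probability_le hx hD1 hp0 hNexp hd hd'' hm hs2 hexp1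
  have hdel := bernoulliProb_not_delocalized_le (V := Fin N) h0 h1 hqp (c := c)
    (τ := p * N / 4000) (δ := 1 / x ^ 42) (t := 1 / 43808000) (l := m) (m := m)
    (ε := 8 * N * Real.exp (-((D + 8) * x ^ 2))) hp0 hphalf hc0 hc1
    (by rw [Fintype.card_fin]; exact hc) (by rw [Fintype.card_fin]; exact hε)
    (by rw [Fintype.card_fin]; exact hε') (by positivity) (by norm_num) (by norm_num) (s := s)
    (by rw [Fintype.card_fin]; exact hs) (by rw [Fintype.card_fin]; exact hrow)
  rw [Fintype.card_fin] at hdel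
  set B : ℝ := 74 * (1 / 2) ^ s with hB
  have hB0 : 0 < B := by positivity
  have hNB : N * B ≤ 148 * Real.exp (1 / 4 * x) := by
    have : ((1 : ℝ) / 2) ^ s ≤ 2 * (Real.exp (1 / 4 * x) / N) := by
      rw [pow_succ] at hs1; linarith
    calc N * B ≤ N * (74 * (2 * (Real.exp (1 / 4 * x) / N))) :=
          mul_le_mul_of_nonneg_left (by rw [hB]; linarith) hNpos.le
      _ = _ := by field_simp; norm_num
  set σ := ∑ i, a i ^ 2 with hσ
  set T := Real.exp x / N * Real.sqrt σ with hT
  have hT0 : 0 < T := by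
    have := Real.sqrt_pos.2 ha0
    positivity
  have hperm := bernoulliProb_hasLargeObservable_le h0 h1 hqperm c hB0 ha hT0 m
  rw [Fintype.card_fin] at hperm
  have hperm' := hperm.trans (permutation_probability_le hx hD1 hNpos hm hm' hB0 hNB ha0 hT
    (by simpa using hexp2))
  have hsub : {X | HasLargeObservable (c • adjacency X) a T} ⊆
      {X | ¬ Delocalized (c • adjacency X) B} ∪
        {X | Delocalized (c • adjacency X) B ∧ HasLargeObservable (c • adjacency X) a T} := by
    intro X hX
    by_cases h : Delocalized (c • adjacency X) B
    · exact Or.inr ⟨h, hX⟩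
    · exact Or.inl h
  refine (bernoulliProb_mono h0 h1 hsub).trans ((bernoulliProb_union_le h0 h1 _ _).trans
    ((add_le_add hdel hperm').trans ?_))
  have hν : Real.exp (-((D + 8) * x ^ 2)) = (N : ℝ) ^ (-D) / N ^ 8 := by
    rw [Real.rpow_def_of_pos hNpos, ← hx2, hNexp, ← Real.exp_nat_mul, ← Real.exp_sub]
    congr 1; push_cast; ring
  rw [hν]
  exact union_bound_arith hNbig (Real.rpow_nonneg hNpos.le _)

end Model

/-! ### Transfer from the abstract probability space to the Bernoulli model. -/

section Law

variable {Ω : Type*} [MeasurableSpace Ω] {μ : Measure Ω} {N : ℕ} {p : ℝ}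
  {𝒜 : Ω → Matrix (Fin N) (Fin N) ℝ}

/-- The edge indicators of a random adjacency matrix. -/
noncomputable def edgeIndicator (𝒜 : Ω → Matrix (Fin N) (Fin N) ℝ) (ω : Ω) (e : Sym2 (Fin N)) :
    Bool :=
  open Classical in decide (𝒜 ω (Sym2.sortEquiv e).1.1 (Sym2.sortEquiv e).1.2 = 1)

theorem adjacency_edgeIndicator (h : IsErdosRenyiAdjacency μ p 𝒜) (ω : Ω) :
    adjacency (edgeIndicator 𝒜 ω) = 𝒜 ω := by
  have key : ∀ i j, i ≤ j → adjacency (edgeIndicator 𝒜 ω) i j = 𝒜 ω i j := by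
    intro i j hij
    have e : Sym2.sortEquiv s(i, j) = ⟨(i, j), hij⟩ := by
      rw [← Equiv.eq_symm_apply]; rfl
    simp only [adjacency, edgeIndicator, e, decide_eq_true_eq]
    rcases h.zero_or_one ω i j with h0 | h1
    · simp [h0]
    · simp [h1]
  ext i j
  rcases le_total i j with hij | hij
  · exact key i j hij
  · have h1 := (h.symm ω).apply i j
    rw [← h1, ← key j i hij]
    simp only [adjacency, Sym2.eq_swap]

/-- Both diagonal conventions become one model, with loop probability p or 0. -/
theorem exists_loopProb (h : IsErdosRenyiAdjacency μ p 𝒜) (hp0 : 0 < p) (hp1 : p < 1) :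
    ∃ q₀ : ℝ, 0 ≤ q₀ ∧ q₀ ≤ 1 ∧ ∀ e : Sym2 (Fin N),
      μ {ω | edgeIndicator 𝒜 ω e = true} = ENNReal.ofReal (edgeProb N p q₀ e) := by
  have hset : ∀ e : Sym2 (Fin N), {ω | edgeIndicator 𝒜 ω e = true}
      = {ω | 𝒜 ω (Sym2.sortEquiv e).1.1 (Sym2.sortEquiv e).1.2 = 1} := by
    intro e; ext ω; simp [edgeIndicator]
  have hsort : ∀ e : Sym2 (Fin N), s((Sym2.sortEquiv e).1.1, (Sym2.sortEquiv e).1.2) = e :=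
    fun e => Sym2.sortEquiv.symm_apply_apply e
  have hoff : ∀ (q₀ : ℝ) (e : Sym2 (Fin N)), ¬ e.IsDiag →
      μ {ω | edgeIndicator 𝒜 ω e = true} = ENNReal.ofReal (edgeProb N p q₀ e) := by
    intro q₀ e he
    rw [hset, edgeProb, if_neg he]
    refine h.bernoulli _ _ (lt_of_le_of_ne (Sym2.sortEquiv e).2 fun hne => he ?_)
    rw [← hsort e, hne]; simp
  have hdiag : ∀ e : Sym2 (Fin N), e.IsDiag →
      (Sym2.sortEquiv e).1.1 = (Sym2.sortEquiv e).1.2 := by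
    intro e he
    rw [← hsort e] at he
    simpa using he
  rcases h.diagonal with hd | hd
  · refine ⟨p, hp0.le, hp1.le, fun e => ?_⟩
    by_cases he : e.IsDiag
    · rw [hset, edgeProb, if_pos he, ← hdiag e he]
      exact hd _
    · exact hoff p e he
  · refine ⟨0, le_rfl, zero_le_one, fun e => ?_⟩
    by_cases he : e.IsDiag
    · rw [hset, edgeProb, if_pos he, ← hdiag e he]
      simp [hd]
    · exact hoff 0 e he

theorem measurableSet_edgeIndicator (h : IsErdosRenyiAdjacency μ p 𝒜) (X : Sym2 (Fin N) → Bool) :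
    MeasurableSet {ω | edgeIndicator 𝒜 ω = X} := by
  have hm : ∀ e b, MeasurableSet {ω | edgeIndicator 𝒜 ω e = b} := by
    intro e b
    have h1 : MeasurableSet {ω | edgeIndicator 𝒜 ω e = true} := by
      have : {ω | edgeIndicator 𝒜 ω e = true}
          = (fun ω => 𝒜 ω (Sym2.sortEquiv e).1.1 (Sym2.sortEquiv e).1.2) ⁻¹' {1} := by
        ext ω; simp [edgeIndicator]
      rw [this]
      exact h.measurable_entry _ _ (measurableSet_singleton 1)
    cases b with
    | true => exact h1
    | false =>
      have : {ω | edgeIndicator 𝒜 ω e = false} = {ω | edgeIndicator 𝒜 ω e = true}ᶜ := by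
        ext ω; simp
      rw [this]
      exact h1.compl
  have : {ω | edgeIndicator 𝒜 ω = X} = ⋂ e, {ω | edgeIndicator 𝒜 ω e = X e} := by
    ext ω; simp [funext_iff]
  rw [this]
  exact MeasurableSet.iInter fun e => hm e _

variable [IsProbabilityMeasure μ]

/-- The edge indicators of the Erdős–Rényi graph have the product Bernoulli law. -/
theorem measureReal_edgeIndicator_eq (h : IsErdosRenyiAdjacency μ p 𝒜) {q₀ : ℝ} (hq0 : 0 ≤ q₀)
    (hp0 : 0 < p)
    (hq : ∀ e : Sym2 (Fin N),
      μ {ω | edgeIndicator 𝒜 ω e = true} = ENNReal.ofReal (edgeProb N p q₀ e))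
    (X : Sym2 (Fin N) → Bool) :
    μ.real {ω | edgeIndicator 𝒜 ω = X} = bernoulliWeight (edgeProb N p q₀) X := by
  have hnn : ∀ e, 0 ≤ edgeProb N p q₀ e := fun e => by
    rw [edgeProb]; split_ifs <;> linarith
  let f : {e : Fin N × Fin N // e.1 ≤ e.2} → Ω → ℝ := fun e ω => 𝒜 ω e.1.1 e.1.2
  let B : {e : Fin N × Fin N // e.1 ≤ e.2} → Set ℝ := fun e =>
    if X (Sym2.sortEquiv.symm e) then {1} else {1}ᶜ
  have hB : ∀ e, MeasurableSet (B e) := by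
    intro e
    simp only [B]
    split_ifs
    · exact measurableSet_singleton 1
    · exact (measurableSet_singleton 1).compl
  have h1 := (iIndepFun_iff_measure_inter_preimage_eq_mul.1 h.indep) Finset.univ (sets := B)
    (fun e _ => hB e)
  have hmem : ∀ (r : ℝ) (b : Bool) [Decidable (r = 1)],
      (r ∈ if b = true then ({1} : Set ℝ) else {1}ᶜ) ↔ decide (r = 1) = b := by
    intro r b _
    cases b <;> simp
  have hset : ∀ e, f e ⁻¹' B e = {ω | edgeIndicator 𝒜 ω (Sym2.sortEquiv.symm e)
      = X (Sym2.sortEquiv.symm e)} := by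
    intro e
    ext ω
    simp only [f, B, edgeIndicator, Set.mem_preimage, Set.mem_ofPred_eq, Equiv.apply_symm_apply]
    exact hmem _ _
  have h2 : {ω | edgeIndicator 𝒜 ω = X} = ⋂ e ∈ (Finset.univ : Finset _), f e ⁻¹' B e := by
    ext ω
    simp only [hset, Set.mem_iInter, Finset.mem_univ, true_implies, Set.mem_ofPred_eq, funext_iff]
    exact ⟨fun h e => h _, fun h e => by simpa using h (Sym2.sortEquiv e)⟩
  rw [h2, measureReal_def, h1, ENNReal.toReal_prod, bernoulliWeight]
  refine Fintype.prod_equiv Sym2.sortEquiv.symm _ _ fun e => ?_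
  change (μ (f e ⁻¹' B e)).toReal = _
  rw [hset]
  set e' := Sym2.sortEquiv.symm e
  have htrue : μ.real {ω | edgeIndicator 𝒜 ω e' = true} = edgeProb N p q₀ e' := by
    rw [measureReal_def, hq, ENNReal.toReal_ofReal (hnn e')]
  by_cases hX : X e' = true
  · simp only [hX, if_true]
    exact htrue
  · rw [Bool.not_eq_true] at hX
    simp only [hX, Bool.false_eq_true, if_false]
    have hm : MeasurableSet {ω | edgeIndicator 𝒜 ω e' = true} := by
      have := h.measurable_entry (Sym2.sortEquiv e').1.1 (Sym2.sortEquiv e').1.2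
        (measurableSet_singleton 1)
      refine cast ?_ this
      congr 1
      ext ω; simp [edgeIndicator]
    have hcompl : {ω | edgeIndicator 𝒜 ω e' = false} = {ω | edgeIndicator 𝒜 ω e' = true}ᶜ := by
      ext ω; simp
    rw [hcompl, ← measureReal_def, probReal_compl_eq_one_sub hm, htrue]

theorem measureReal_preimage_edgeIndicator (h : IsErdosRenyiAdjacency μ p 𝒜) {q₀ : ℝ}
    (hq0 : 0 ≤ q₀) (hp0 : 0 < p)
    (hq : ∀ e : Sym2 (Fin N),
      μ {ω | edgeIndicator 𝒜 ω e = true} = ENNReal.ofReal (edgeProb N p q₀ e))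
    (S : Set (Sym2 (Fin N) → Bool)) :
    μ.real {ω | edgeIndicator 𝒜 ω ∈ S} = bernoulliProb (edgeProb N p q₀) S := by
  classical
  have h1 : {ω | edgeIndicator 𝒜 ω ∈ S}
      = ⋃ X ∈ Finset.univ.filter (· ∈ S), {ω | edgeIndicator 𝒜 ω = X} := by
    ext ω; simp
  rw [h1, measureReal_biUnion_finset]
  · rw [bernoulliProb, bernoulliExp, Finset.sum_filter]
    refine Finset.sum_congr rfl fun X _ => ?_
    rw [measureReal_edgeIndicator_eq h hq0 hp0 hq]
    by_cases hX : X ∈ S <;> simp [hX]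
  · intro X _ Y _ hXY
    rw [Function.onFun, Set.disjoint_left]
    intro ω hω hω'
    exact hXY (hω.symm.trans hω')
  · exact fun X _ => measurableSet_edgeIndicator h X

end Law

/-! ### Conclusion. -/

theorem theorem2p8 :
    -- the absolute constant implicit in the `O`
    ∃ K : ℝ, 0 < K ∧
    ∀ D : ℝ, 0 < D →
    ∃ C : ℝ, 0 < C ∧ ∃ N₀ : ℕ,
    ∀ (Ω : Type*) [MeasurableSpace Ω] (μ : Measure Ω) [IsProbabilityMeasure μ]
      (N : ℕ) (p : ℝ) (𝒜 : Ω → Matrix (Fin N) (Fin N) ℝ),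
      N₀ ≤ N → 0 < p → p < 1 →
      C ^ 2 * Real.log N ≤ p * N →
      Real.sqrt (p * N) ≤ Real.log N ^ 10 →
      IsErdosRenyiAdjacency μ p 𝒜 →
    ∀ a : Fin N → ℝ, ∑ i, a i = 0 →
    ∀ (k : Fin N) (θ : ℝ), 1 ≤ θ →
      1 - (N : ℝ) ^ (-D) - Real.exp (-(θ * Real.sqrt (Real.log θ))) ≤
        μ.real {ω | ∀ u : Fin N → ℝ,
          IsKthUnitEigenvector (rescaledAdjacency p (𝒜 ω)) k u →
          |∑ i, a i * u i ^ 2| ≤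
            K * (θ ^ 2 * (N : ℝ) ^ ((Real.log N) ^ (-(1 / 2) : ℝ)) / N *
              Real.sqrt (∑ i, a i ^ 2))} := by
  refine ⟨1, one_pos, fun D hD => ⟨16000000 * (D + 8), by positivity, ?_⟩⟩
  obtain ⟨N₀, hN₀⟩ := exists_log_threshold (128 * 148 ^ 4 * (D + 8))
  refine ⟨N₀, fun Ω _ μ _ N p 𝒜 hN hp0 hp1 hd hd' h𝒜 a ha k θ hθ => ?_⟩
  obtain ⟨hlog, hexp1, hexp2⟩ := hN₀ N hN
  have hNpos : (0 : ℝ) < N := by exact_mod_cast Fin.pos k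
  obtain ⟨q₀, hq0, hq1, hq⟩ := exists_loopProb h𝒜 hp0 hp1
  have hrpow : (N : ℝ) ^ ((Real.log N) ^ (-(1 / 2) : ℝ))
      = Real.exp (Real.sqrt (Real.log N)) := by
    have hl : 0 < Real.log N := by linarith
    rw [Real.rpow_def_of_pos hNpos, Real.sqrt_eq_rpow]
    congr 1
    nth_rewrite 1 [← Real.rpow_one (Real.log N)]
    rw [← Real.rpow_add hl]
    norm_num
  set T := Real.exp (Real.sqrt (Real.log N)) / N * Real.sqrt (∑ i, a i ^ 2) with hT
  set S := {X : Sym2 (Fin N) → Bool | HasLargeObservable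
    (Real.sqrt (1 / (p * (1 - p) * N)) • adjacency X) a T} with hS
  have hprob : bernoulliProb (edgeProb N p q₀) S ≤ (N : ℝ) ^ (-D) := by
    have hσ : 0 ≤ ∑ i, a i ^ 2 := Finset.sum_nonneg fun _ _ => sq_nonneg _
    -- Zero weights are treated apart, since the tail bound needs T > 0; then both sides vanish and
    -- the strict inequality fails.
    rcases hσ.eq_or_lt with h0 | h0
    · have ha0 : ∀ i, a i = 0 := fun i => by
        have := (Finset.sum_eq_zero_iff_of_nonneg fun i _ => sq_nonneg (a i)).1 h0.symm i
          (Finset.mem_univ i)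
        exact pow_eq_zero_iff (two_ne_zero) |>.1 this
      have hSe : S = ∅ := by
        rw [Set.eq_empty_iff_forall_notMem]
        rintro X ⟨lam, u, -, hlt⟩
        simp [ha0, hT] at hlt
      rw [hSe]
      simp only [bernoulliProb, bernoulliExp, Set.indicator_empty, mul_zero,
        Finset.sum_const_zero]
      positivity
    · exact bernoulliProb_hasLargeObservable_le_rpow hD hlog hexp1 hexp2 hp0 hp1 hq0 hq1 hd hd' ha h0
  have hgood : 1 - (N : ℝ) ^ (-D) ≤ μ.real {ω | edgeIndicator 𝒜 ω ∈ Sᶜ} := by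
    rw [measureReal_preimage_edgeIndicator h𝒜 hq0 hp0 hq]
    have := bernoulliProb_add_compl (q := edgeProb N p q₀) S
    linarith
  have hsub : {ω | edgeIndicator 𝒜 ω ∈ Sᶜ} ⊆ {ω | ∀ u : Fin N → ℝ,
          IsKthUnitEigenvector (rescaledAdjacency p (𝒜 ω)) k u →
          |∑ i, a i * u i ^ 2| ≤
            1 * (θ ^ 2 * (N : ℝ) ^ ((Real.log N) ^ (-(1 / 2) : ℝ)) / N *
              Real.sqrt (∑ i, a i ^ 2))} := by
    rintro ω hω u ⟨hM, hu, hu1⟩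
    by_contra hlt
    push Not at hlt
    refine hω ⟨hM.eigenvalues₀ (k.cast (Fintype.card_fin N).symm), u, ⟨?_, hu1⟩,
      lt_of_le_of_lt ?_ hlt⟩
    · rw [adjacency_edgeIndicator h𝒜]
      exact hu
    · rw [hrpow, one_mul, hT]
      -- The bound holds with θ = 1, and the factor θ² only relaxes it.
      have hθ2 : 1 ≤ θ ^ 2 := one_le_pow₀ hθ
      gcongr
      exact le_mul_of_one_le_left (Real.exp_nonneg _) hθ2
  have hmono : μ.real {ω | edgeIndicator 𝒜 ω ∈ Sᶜ} ≤ μ.real _ := measureReal_mono hsub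
  have := Real.exp_pos (-(θ * Real.sqrt (Real.log θ)))
  linarith
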